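/- Let $X$ be a compact smooth manifold (without boundary) and let $\pi:V\to X$ be an $Sp_{2k}(\mathbb R)$-bundle, i.e. a smooth real vector bundle of rank $2k$ together with a family of smooth local trivialisations covering $X$ whose transition functions take values in the group $Sp_{2k}(\mathbb R)$ of real symplectic $2k\times 2k$ matrices. Let $\omega$ be the symplectic form on $V$ given by the standard symplectic form of $\mathbb R^{2k}$ in any of these trivialisations. A vector bundle automorphism of $V$ is a diffeomorphism $V\to V$ that covers $\mathrm{id}_X$ and is linear on the fibres; it is symplectic if it preserves $\omega$, and unipotent if it is unipotent on every fibre. Let $S$ be a symplectic vector bundle automorphism of $V$ that is nullhomotopic, i.e. there is a continuous family $S_t$, $t\in[0,1]$, of symplectic vector bundle automorphisms with $S_0=\mathrm{id}$ and $S_1=S$. Then there exist finitely many unipotent symplectic vector bundle automorphisms $E_1,\dots,E_N$ of $V$ such that $$S=E_N\circ\cdots\circ E_1,$$ and for all $j$ we have $(E_j-\mathrm{id})^2=0$ and, at every point of $X$, $\mathrm{rank}(E_j-\mathrm{id})\in\{0,1,2\}$. Suppose moreover that $V$ is Lagrangian, i.e. that all transition matrices have the block-diagonal form $\begin{bmatrix}A&0\\0&B\end{bmatrix}$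 with $k\times k$ blocks, and let $V=L_1\oplus L_2$ be the resulting splitting into Lagrangian subbundles. Then the $E_j$ can in addition be chosen to respect this splitting: for each $j$ there are smooth sections $v,w$ of $V$ with $\omega(v,w)=0$, either both with values in $L_1$ or both with values in $L_2$, such that $$E_j(u)=u+\omega(u,v)\,w+\omega(u,w)\,v .$$ -/

import Mathlib

open scoped Manifold ContDiff Bundle

noncomputable section

namespace RealSymp

open Bundle

/-- The model fibre `ℝ^{2k} = ℝ^k ⊕ ℝ^k`. -/
abbrev Fib (k : ℕ) : Type := Fin k ⊕ Fin k → ℝ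

/-- The standard symplectic form `ω₀(u, v) = uᵀ Ω v` with `Ω = [0, 1; -1, 0]`, that is,
`ω₀(u, v) = ∑ i, (u i * v (k + i) - u (k + i) * v i)`. -/
def stdForm (k : ℕ) : LinearMap.BilinForm ℝ (Fib k) :=
  Matrix.toBilin' (-Matrix.J (Fin k) ℝ)

theorem stdForm_apply {k : ℕ} (u v : Fib k) :
    stdForm k u v = ∑ i, (u (Sum.inl i) * v (Sum.inr i) - u (Sum.inr i) * v (Sum.inl i)) := by
  simp [stdForm, Matrix.toBilin'_apply', Matrix.J, dotProduct,
    Matrix.mulVec, Fintype.sum_sum_type, Matrix.one_apply, Finset.sum_sub_distrib,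
    Matrix.fromBlocks]
  ring

theorem stdForm_mulVec {k : ℕ} {A : Matrix (Fin k ⊕ Fin k) (Fin k ⊕ Fin k) ℝ}
    (hA : A ∈ Matrix.symplecticGroup (Fin k) ℝ) (u v : Fib k) :
    stdForm k (A.mulVec u) (A.mulVec v) = stdForm k u v := by
  have h : A.transpose * Matrix.J (Fin k) ℝ * A = Matrix.J (Fin k) ℝ :=
    SymplecticGroup.mem_iff'.1 hA
  have h2 : A.transpose * (-Matrix.J (Fin k) ℝ) * A = -Matrix.J (Fin k) ℝ := by
    rw [mul_neg, neg_mul, h]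
  rw [stdForm, Matrix.toBilin'_apply', Matrix.toBilin'_apply']
  conv_rhs => rw [← h2]
  rw [← Matrix.mulVec_mulVec, ← Matrix.mulVec_mulVec, Matrix.dotProduct_mulVec u,
    Matrix.vecMul_transpose]

section Bundles

variable {n k : ℕ} {X : Type*} [TopologicalSpace X] [ChartedSpace (EuclideanSpace ℝ (Fin n)) X]
  {V : X → Type*} [TopologicalSpace (TotalSpace (Fib k) V)]
  [∀ x, AddCommGroup (V x)] [∀ x, Module ℝ (V x)] [∀ x, TopologicalSpace (V x)]
  [FiberBundle (Fib k) V]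

variable (n k V) in
/-- An `Sp_{2k}(ℝ)`-structure on a smooth real vector bundle `V` of rank `2k`: a family of smooth
local trivialisations that cover the base and whose transition functions take values in the group
of real symplectic `2k × 2k` matrices. -/
structure SpStructure where
  /-- the special family of trivialisations -/
  trivs : Set (Trivialization (Fib k) (π (Fib k) V))
  isLinear : ∀ e ∈ trivs, e.IsLinear ℝ
  contMDiffOn_toFun : ∀ e ∈ trivs,
    ContMDiffOn ((𝓡 n).prod 𝓘(ℝ, Fib k)) ((𝓡 n).prod 𝓘(ℝ, Fib k)) ∞ e e.source
  contMDiffOn_symm : ∀ e ∈ trivs,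
    ContMDiffOn ((𝓡 n).prod 𝓘(ℝ, Fib k)) ((𝓡 n).prod 𝓘(ℝ, Fib k)) ∞
      e.toOpenPartialHomeomorph.symm e.target
  cover : ∀ x : X, ∃ e ∈ trivs, x ∈ e.baseSet
  transition : ∀ e ∈ trivs, ∀ e' ∈ trivs, ∀ x ∈ e.baseSet ∩ e'.baseSet,
    ∃ A ∈ Matrix.symplecticGroup (Fin k) ℝ, ∀ y : Fib k, e.coordChange e' x y = A.mulVec y

namespace SpStructure

variable (σ : SpStructure n k V)

/-- A trivialisation of the special family around `x`. -/
def trivAt (x : X) : Trivialization (Fib k) (π (Fib k) V) := (σ.cover x).choose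

theorem trivAt_mem (x : X) : σ.trivAt x ∈ σ.trivs := (σ.cover x).choose_spec.1

theorem mem_baseSet_trivAt (x : X) : x ∈ (σ.trivAt x).baseSet := (σ.cover x).choose_spec.2

/-- The linear coordinates on the fibre `V x` in a trivialisation of the special family. -/
def coord (x : X) : V x ≃ₗ[ℝ] Fib k :=
  haveI := σ.isLinear _ (σ.trivAt_mem x)
  (σ.trivAt x).linearEquivAt ℝ x (σ.mem_baseSet_trivAt x)

theorem coord_apply (x : X) (u : V x) : σ.coord x u = (σ.trivAt x ⟨x, u⟩).2 := rfl

theorem coordChange_coord {e : Trivialization (Fib k) (π (Fib k) V)}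
    {x : X} (u : V x) :
    (σ.trivAt x).coordChange e x (σ.coord x u) = (e ⟨x, u⟩).2 := by
  rw [coord_apply]
  exact (σ.trivAt x).coordChange_apply_snd e (p := ⟨x, u⟩) (σ.mem_baseSet_trivAt x)

/-- The natural symplectic form of an `Sp_{2k}(ℝ)`-bundle: the standard one in any trivialisation
of the special family (see `form_eq`). -/
def form (x : X) : LinearMap.BilinForm ℝ (V x) :=
  (stdForm k).comp (σ.coord x).toLinearMap (σ.coord x).toLinearMap

theorem form_eq {e : Trivialization (Fib k) (π (Fib k) V)} (he : e ∈ σ.trivs)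
    {x : X} (hx : x ∈ e.baseSet) (u v : V x) :
    σ.form x u v = stdForm k (e ⟨x, u⟩).2 (e ⟨x, v⟩).2 := by
  obtain ⟨A, hA, h⟩ := σ.transition _ (σ.trivAt_mem x) e he x ⟨σ.mem_baseSet_trivAt x, hx⟩
  rw [← σ.coordChange_coord u, ← σ.coordChange_coord v, h, h, stdForm_mulVec hA]
  rfl

/-- The bundle is Lagrangian if all transition matrices of the special family are of the
block-diagonal form `[A, 0; 0, B]` with `k × k` blocks. -/
def IsLagrangian : Prop :=
  ∀ e ∈ σ.trivs, ∀ e' ∈ σ.trivs, ∀ x ∈ e.baseSet ∩ e'.baseSet,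
    ∃ A B : Matrix (Fin k) (Fin k) ℝ, ∀ y : Fib k,
      e.coordChange e' x y = (Matrix.fromBlocks A 0 0 B).mulVec y

/-- The first Lagrangian subspace: the vectors whose last `k` coordinates vanish, in one (by
`mem_L₁_iff`, in each) trivialisation of the special family of a Lagrangian bundle. -/
def L₁ (x : X) : Submodule ℝ (V x) where
  carrier := {u | ∀ i, σ.coord x u (Sum.inr i) = 0}
  add_mem' hu hv i := by simp_all
  zero_mem' i := by simp
  smul_mem' c u hu i := by simp_all

/-- The second Lagrangian subspace: the vectors whose first `k` coordinates vanish, in one (by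
`mem_L₂_iff`, in each) trivialisation of the special family of a Lagrangian bundle. -/
def L₂ (x : X) : Submodule ℝ (V x) where
  carrier := {u | ∀ i, σ.coord x u (Sum.inl i) = 0}
  add_mem' hu hv i := by simp_all
  zero_mem' i := by simp
  smul_mem' c u hu i := by simp_all

theorem mem_L₁_iff (hσ : σ.IsLagrangian) {e : Trivialization (Fib k) (π (Fib k) V)}
    (he : e ∈ σ.trivs) {x : X} (hx : x ∈ e.baseSet) (u : V x) :
    u ∈ σ.L₁ x ↔ ∀ i, (e ⟨x, u⟩).2 (Sum.inr i) = 0 := by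
  have hm := σ.mem_baseSet_trivAt x
  constructor
  · intro hu i
    have hu' : ∀ i, σ.coord x u (Sum.inr i) = 0 := hu
    obtain ⟨A, B, h⟩ := hσ _ (σ.trivAt_mem x) e he x ⟨hm, hx⟩
    rw [← σ.coordChange_coord u, h]
    simp [Matrix.mulVec, dotProduct, hu']
  · intro hu i
    obtain ⟨A, B, h⟩ := hσ e he _ (σ.trivAt_mem x) x ⟨hx, hm⟩
    rw [coord_apply, ← e.coordChange_apply_snd (σ.trivAt x) (p := ⟨x, u⟩) hx, h]
    simp [Matrix.mulVec, dotProduct, hu]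

theorem mem_L₂_iff (hσ : σ.IsLagrangian) {e : Trivialization (Fib k) (π (Fib k) V)}
    (he : e ∈ σ.trivs) {x : X} (hx : x ∈ e.baseSet) (u : V x) :
    u ∈ σ.L₂ x ↔ ∀ i, (e ⟨x, u⟩).2 (Sum.inl i) = 0 := by
  have hm := σ.mem_baseSet_trivAt x
  constructor
  · intro hu i
    have hu' : ∀ i, σ.coord x u (Sum.inl i) = 0 := hu
    obtain ⟨A, B, h⟩ := hσ _ (σ.trivAt_mem x) e he x ⟨hm, hx⟩
    rw [← σ.coordChange_coord u, h]
    simp [Matrix.mulVec, dotProduct, hu']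
  · intro hu i
    obtain ⟨A, B, h⟩ := hσ e he _ (σ.trivAt_mem x) x ⟨hx, hm⟩
    rw [coord_apply, ← e.coordChange_apply_snd (σ.trivAt x) (p := ⟨x, u⟩) hx, h]
    simp [Matrix.mulVec, dotProduct, hu]

end SpStructure

variable (n k V) in
/-- A vector bundle automorphism of `V`: a diffeomorphism of the total space that covers the
identity of `X` and is linear on each fibre. -/
structure BundleAut where
  /-- the linear automorphism of each fibre -/
  fib : ∀ x, V x ≃ₗ[ℝ] V x
  contMDiff_toFun :
    ContMDiff ((𝓡 n).prod 𝓘(ℝ, Fib k)) ((𝓡 n).prod 𝓘(ℝ, Fib k)) ∞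
      (fun p : TotalSpace (Fib k) V => (⟨p.1, fib p.1 p.2⟩ : TotalSpace (Fib k) V))
  contMDiff_invFun :
    ContMDiff ((𝓡 n).prod 𝓘(ℝ, Fib k)) ((𝓡 n).prod 𝓘(ℝ, Fib k)) ∞
      (fun p : TotalSpace (Fib k) V => (⟨p.1, (fib p.1).symm p.2⟩ : TotalSpace (Fib k) V))

namespace BundleAut

/-- The fibrewise endomorphism `E - id`. -/
def subId (E : BundleAut n k V) (x : X) : Module.End ℝ (V x) :=
  (E.fib x).toLinearMap - LinearMap.id

/-- The automorphism preserves the symplectic form. -/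
def IsSymplectic (σ : SpStructure n k V) (E : BundleAut n k V) : Prop :=
  ∀ (x : X) (u v : V x), σ.form x (E.fib x u) (E.fib x v) = σ.form x u v

/-- The automorphism is unipotent on each fibre. -/
def IsUnipotent (E : BundleAut n k V) : Prop :=
  ∀ x : X, ∃ m : ℕ, E.subId x ^ m = 0

/-- `S` is nullhomotopic as a symplectic automorphism: it is joined to the identity by a
continuous family of symplectic vector bundle automorphisms. -/
def IsNullhomotopic (σ : SpStructure n k V) (S : BundleAut n k V) : Prop :=
  ∃ H : unitInterval → BundleAut n k V,
    Continuous (fun p : unitInterval × TotalSpace (Fib k) V =>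
      (⟨p.2.1, (H p.1).fib p.2.1 p.2.2⟩ : TotalSpace (Fib k) V)) ∧
    (∀ t, (H t).IsSymplectic σ) ∧
    (∀ (x : X) (u : V x), (H 0).fib x u = u) ∧
    H 1 = S

/-- `E` has the form `E(u) = u + ω(u, v) w + ω(u, w) v` with smooth sections `v`, `w` such that
`ω(v, w) = 0`, where both `v` and `w` take values in the first, or both in the second, summand of
the Lagrangian splitting. -/
def RespectsSplitting (σ : SpStructure n k V) (E : BundleAut n k V) : Prop :=
  ∃ v w : ∀ x, V x,
    ContMDiff (𝓡 n) ((𝓡 n).prod 𝓘(ℝ, Fib k)) ∞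
      (fun x => (⟨x, v x⟩ : TotalSpace (Fib k) V)) ∧
    ContMDiff (𝓡 n) ((𝓡 n).prod 𝓘(ℝ, Fib k)) ∞
      (fun x => (⟨x, w x⟩ : TotalSpace (Fib k) V)) ∧
    (∀ x, σ.form x (v x) (w x) = 0) ∧
    (∀ x (u : V x), E.fib x u = u + σ.form x u (v x) • w x + σ.form x u (w x) • v x) ∧
    ((∀ x, v x ∈ σ.L₁ x ∧ w x ∈ σ.L₁ x) ∨ (∀ x, v x ∈ σ.L₂ x ∧ w x ∈ σ.L₂ x))

/-- A unipotent symplectic automorphism with `(E - id)² = 0` and `rank (E - id) ∈ {0, 1, 2}`. -/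
def IsElementaryFactor (σ : SpStructure n k V) (E : BundleAut n k V) : Prop :=
  E.IsSymplectic σ ∧ E.IsUnipotent ∧
    ∀ x : X, E.subId x ^ 2 = 0 ∧ (E.subId x).rank ≤ 2

/-- `S = E_N ∘ ⋯ ∘ E_1`, where the list is `[E_N, …, E_1]`. -/
def IsComposition (S : BundleAut n k V) (E : List (BundleAut n k V)) : Prop :=
  ∀ x : X, S.fib x = (E.map fun T => T.fib x).prod

end BundleAut

end Bundles

end RealSymp

end

/-! The automorphisms that are finite products of transvections `u ↦ u + ω(u, v) w + ω(u, w) v` with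
`ω(v, w) = 0` form a group. Along the homotopy, `H t = (H t ∘ (H t₀)⁻¹) ∘ H t₀`, and the first
factor tends to the identity as `t → t₀`. So once every symplectic automorphism near the identity is
such a product (`eventually_isFactorable`), being a product is a locally constant property of `t`;
it holds at `t = 0` and the interval is connected.

Near the identity the problem is first solved for matrices (`exists_elemShear_factorization`). A
symplectic `[A, B; C, D]` with `D` invertible is, by block elimination, a lower shear, a block
`diag(Dᵀ, D⁻¹)` and an upper shear up to inversion. The diagonal block is reduced to shears in two
steps: `Dᵀ` near `1` is analytically `(1 + X₁)(1 + X₂ Λ)` with symmetric `X₁`, `X₂`, `Λ`, and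
`diag(1 + X Y, (1 + Y X)⁻¹)` is a product of four symmetric shears. Symmetric shears split further
into elementary ones, which are transvections along basis vectors of one Lagrangian summand.

The matrix result is carried to the bundle by cutoff functions (`exists_local_correction`): an
automorphism near the identity is multiplied by a factorable one so that the product is the identity
where the cutoff equals `1`, stays so where it already was, and remains near the identity. Finitely
many cutoffs exhaust the compact base. -/

namespace RealSymp

open Filter Topology Bundle
open scoped Matrix.Norms.Operator

/-! ### Block shears and their products. -/

section BlockMatrices

variable {k : ℕ}

/-- Endomorphisms of the model fibre. -/
abbrev FibMat (k : ℕ) : Type := Matrix (Fin k ⊕ Fin k) (Fin k ⊕ Fin k) ℝ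

/-- The shear `[1, -X; 0, 1]` (for `true`) or `[1, 0; X, 1]` (for `false`). -/
noncomputable def shear (s : Bool) (X : Matrix (Fin k) (Fin k) ℝ) :
    FibMat k :=
  if s then Matrix.fromBlocks 1 (-X) 0 1 else Matrix.fromBlocks 1 0 X 1

@[simp] theorem shear_zero (s : Bool) : shear s (0 : Matrix (Fin k) (Fin k) ℝ) = 1 := by
  cases s <;> simp [shear]

theorem shear_add (s : Bool) (X Y : Matrix (Fin k) (Fin k) ℝ) :
    shear s (X + Y) = shear s X * shear s Y := by
  cases s <;> simp [shear, Matrix.fromBlocks_multiply, add_comm]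

theorem shear_list_sum {α : Type*} (s : Bool) (l : List α) (f : α → Matrix (Fin k) (Fin k) ℝ) :
    shear s (l.map f).sum = (l.map fun a => shear s (f a)).prod := by
  induction l with
  | nil => simp
  | cons a l ih => simp [shear_add, ih]

/-- The elementary shear with parameter `t` in the direction of `e_a e_bᵀ + e_b e_aᵀ`. -/
noncomputable def elemShear (g : Bool × Fin k × Fin k) (t : ℝ) :
    FibMat k :=
  shear g.1 (t • (Matrix.single g.2.1 g.2.2 1 + Matrix.single g.2.2 g.2.1 1))

/-- Shears of one type add their parameters, and `X = ∑ (X i j / 2) (E_ij + E_ji)` over all ordered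
pairs. The `1/2` accounts for each off-diagonal pair occurring twice and for `E_ii + E_ii` on the
diagonal. -/
theorem shear_eq_prod_elemShear (s : Bool) {X : Matrix (Fin k) (Fin k) ℝ} (hX : X.IsSymm) :
    shear s X = ((Finset.univ : Finset (Fin k × Fin k)).toList.map fun p =>
      elemShear (s, p) (X p.1 p.2 / 2)).prod := by
  have h : ((Finset.univ : Finset (Fin k × Fin k)).toList.map fun p =>
      (X p.1 p.2 / 2) • ((Matrix.single p.1 p.2 1 + Matrix.single p.2 p.1 1 :
        Matrix (Fin k) (Fin k) ℝ))).sum = X := by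
    rw [Finset.sum_map_toList, Fintype.sum_prod_type]
    simp only [smul_add, Matrix.smul_single, smul_eq_mul, mul_one, Finset.sum_add_distrib]
    ext i j
    have := hX.apply i j
    simp [Matrix.sum_apply, Matrix.single_apply, ite_and]
    linarith
  conv_lhs => rw [← h]
  rw [shear_list_sum]
  rfl

/-- Block elimination applied to `[1 + X Y, X; Y, 1]`, the product of the two rightmost shears: one
lower and one upper shear clear the off-diagonal blocks. The identities used are `Y (1 + X Y) = (1 +
Y X) Y` and `X + X Y X = X (1 + Y X)`. For symmetric `X` and `Y` all four parameters are symmetric.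
-/
theorem shear_mul_four {X Y : Matrix (Fin k) (Fin k) ℝ} (h : IsUnit (1 + Y * X).det) :
    shear true (X + X * Y * X) * (shear false (-((1 + Y * X)⁻¹ * Y)) *
      (shear true (-X) * shear false Y)) = Matrix.fromBlocks (1 + X * Y) 0 0 (1 + Y * X)⁻¹ := by
  have h1 : (1 + Y * X)⁻¹ * (1 + Y * X) = 1 := Matrix.nonsing_inv_mul _ h
  have h2 : (X + X * Y * X) * (1 + Y * X)⁻¹ = X := by
    have : X + X * Y * X = X * (1 + Y * X) := by noncomm_ring
    rw [this, Matrix.mul_assoc, Matrix.mul_nonsing_inv _ h, Matrix.mul_one]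
  have h3 : (1 + Y * X)⁻¹ * Y * X = 1 - (1 + Y * X)⁻¹ := by
    rw [Matrix.mul_add, Matrix.mul_one] at h1
    rw [Matrix.mul_assoc]
    exact eq_sub_of_add_eq' h1
  have h4 : (1 + Y * X)⁻¹ * Y * (1 + X * Y) = Y := by
    rw [Matrix.mul_add, ← Matrix.mul_assoc, h3]
    noncomm_ring
  have e1 : shear true (-X) * shear false Y = Matrix.fromBlocks (1 + X * Y) X Y 1 := by
    simp [shear, Matrix.fromBlocks_multiply]
  have e2 : shear false (-((1 + Y * X)⁻¹ * Y)) * Matrix.fromBlocks (1 + X * Y) X Y 1 =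
      Matrix.fromBlocks (1 + X * Y) X 0 (1 + Y * X)⁻¹ := by
    simp [shear, Matrix.fromBlocks_multiply, h3, h4]
  rw [e1, e2]
  simp only [shear, if_true, Matrix.fromBlocks_multiply, Matrix.neg_mul, h2]
  simp

end BlockMatrices

/-! ### Matrices near the identity as products built from symmetric matrices. -/

section Symmetrization

variable {k : ℕ}

/-- The diagonal matrix with entries `0, …, k - 1`. -/
noncomputable def diagRange (k : ℕ) : Matrix (Fin k) (Fin k) ℝ := Matrix.diagonal fun i => (i : ℝ)

/-- The symmetric matrix `X` for which `Z - X * diagRange k` is symmetric. -/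
noncomputable def symPart (k : ℕ) : Matrix (Fin k) (Fin k) ℝ →ₗ[ℝ] Matrix (Fin k) (Fin k) ℝ where
  toFun Z := Matrix.of fun i j => (Z i j - Z j i) / ((j : ℝ) - i)
  map_add' Z W := by ext i j; simp; ring
  map_smul' c Z := by ext i j; simp; ring

theorem symPart_isSymm (Z : Matrix (Fin k) (Fin k) ℝ) : (symPart k Z).IsSymm := by
  ext i j
  simp only [symPart, LinearMap.coe_mk, AddHom.coe_mk, Matrix.transpose_apply, Matrix.of_apply]
  rw [← neg_sub (Z i j), ← neg_sub (j : ℝ) (i : ℝ), neg_div_neg_eq]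

/-- With `X = symPart k Z`, symmetry amounts to `X i j * (j - i) = Z i j - Z j i`, which is solvable
because the entries of `diagRange k` are distinct. On the diagonal `symPart` is `0 / 0 = 0`. -/
theorem sub_symPart_mul_isSymm (Z : Matrix (Fin k) (Fin k) ℝ) :
    (Z - symPart k Z * diagRange k).IsSymm := by
  ext i j
  simp only [symPart, diagRange, LinearMap.coe_mk, AddHom.coe_mk, Matrix.transpose_apply,
    Matrix.of_apply, Matrix.sub_apply, Matrix.mul_diagonal]
  by_cases h : i = j
  · simp [h]
  · have h1 : (j : ℝ) - i ≠ 0 := by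
      rw [sub_ne_zero]
      exact fun h' => h (Fin.ext (by exact_mod_cast h'.symm))
    have h2 : (i : ℝ) - j ≠ 0 := by rw [← neg_sub]; exact neg_ne_zero.2 h1
    field_simp
    ring

/-- Near the identity, a matrix is smoothly a product `(1 + X₁) (1 + X₂ Λ)` with symmetric `X₁`,
`X₂` and a fixed symmetric matrix `Λ`. -/
theorem exists_symm_factorization (k : ℕ) :
    ∃ X₁ X₂ : Matrix (Fin k) (Fin k) ℝ → Matrix (Fin k) (Fin k) ℝ,
      ContDiffAt ℝ ω X₁ 1 ∧ ContDiffAt ℝ ω X₂ 1 ∧ X₁ 1 = 0 ∧ X₂ 1 = 0 ∧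
      (∀ Q, (X₁ Q).IsSymm) ∧ (∀ Q, (X₂ Q).IsSymm) ∧
      ∀ᶠ Q in 𝓝 1, (1 + X₁ Q) * (1 + X₂ Q * diagRange k) = Q := by
  let ℓ : Matrix (Fin k) (Fin k) ℝ →L[ℝ] Matrix (Fin k) (Fin k) ℝ :=
    LinearMap.toContinuousLinearMap (symPart k)
  let b : Matrix (Fin k) (Fin k) ℝ →L[ℝ] Matrix (Fin k) (Fin k) ℝ :=
    LinearMap.toContinuousLinearMap ((LinearMap.mulRight ℝ (diagRange k)).comp (symPart k))
  let a : Matrix (Fin k) (Fin k) ℝ →L[ℝ] Matrix (Fin k) (Fin k) ℝ :=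
    ContinuousLinearMap.id ℝ _ - b
  -- Since `a + b = id`, the derivative of `Φ` at `0` is the identity, and the inverse function
  -- theorem gives the factorisation.
  let Φ : Matrix (Fin k) (Fin k) ℝ → Matrix (Fin k) (Fin k) ℝ :=
    (fun Z => 1 + a Z) * (fun Z => 1 + b Z)
  have hΦ : ContDiffAt ℝ ω Φ 0 := by
    have h1 : ContDiff ℝ ω (fun Z => 1 + a Z) := contDiff_const.add a.contDiff
    have h2 : ContDiff ℝ ω (fun Z => 1 + b Z) := contDiff_const.add b.contDiff
    exact (h1.mul h2).contDiffAt
  have hd : HasFDerivAt Φ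
      ((ContinuousLinearEquiv.refl ℝ (Matrix (Fin k) (Fin k) ℝ) :
        Matrix (Fin k) (Fin k) ℝ →L[ℝ] Matrix (Fin k) (Fin k) ℝ)) 0 := by
    have h1 : HasFDerivAt (fun Z => 1 + a Z) a 0 := a.hasFDerivAt.const_add 1
    have h2 : HasFDerivAt (fun Z => 1 + b Z) b 0 := b.hasFDerivAt.const_add 1
    refine (h1.mul' h2).congr_fderiv ?_
    have h00 : (1 : Matrix (Fin k) (Fin k) ℝ) + a 0 = 1 := by rw [map_zero, add_zero]
    have h01 : (1 : Matrix (Fin k) (Fin k) ℝ) + b 0 = 1 := by rw [map_zero, add_zero]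
    refine ContinuousLinearMap.ext fun Z => ?_
    change (1 + a 0) * b Z + (Z - b Z) * (1 + b 0) = Z
    rw [h00, h01, one_mul, mul_one, add_sub_cancel]
  have hω : (ω : WithTop ℕ∞) ≠ 0 := by simp
  have h0 : Φ 0 = 1 := by simp [Φ]
  let Ψ := hΦ.localInverse hd hω
  have hΨ : ContDiffAt ℝ ω Ψ 1 := h0 ▸ hΦ.to_localInverse hd hω
  have hΨ1 : Ψ 1 = 0 := by
    have := (hΦ.hasStrictFDerivAt' hd hω).localInverse_apply_image
    rw [h0] at this
    exact this
  refine ⟨fun Q => a (Ψ Q), fun Q => ℓ (Ψ Q), a.contDiff.contDiffAt.comp 1 hΨ,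
    ℓ.contDiff.contDiffAt.comp 1 hΨ, by simp [hΨ1], by simp [hΨ1],
    fun Q => sub_symPart_mul_isSymm _, fun Q => symPart_isSymm _, ?_⟩
  have := (hΦ.hasStrictFDerivAt' hd hω).eventually_right_inverse
  rw [h0] at this
  exact this

end Symmetrization

/-! ### Factorisation of symplectic matrices near the identity. -/

section Factorization

variable {k : ℕ}

theorem fromBlocks_symplectic {A B C D : Matrix (Fin k) (Fin k) ℝ}
    (h : Matrix.fromBlocks A B C D ∈ Matrix.symplecticGroup (Fin k) ℝ) :
    B.transpose * D = D.transpose * B ∧ C * D.transpose = D * C.transpose ∧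
      D.transpose * A - B.transpose * C = 1 := by
  have h1 := SymplecticGroup.mem_iff'.1 h
  have h2 := SymplecticGroup.mem_iff.1 h
  simp only [Matrix.J, Matrix.fromBlocks_transpose, Matrix.fromBlocks_multiply] at h1 h2
  obtain ⟨-, -, h3, h4⟩ := Matrix.fromBlocks_inj.1 h1
  obtain ⟨-, -, -, h5⟩ := Matrix.fromBlocks_inj.1 h2
  simp only [Matrix.mul_zero, Matrix.mul_one, Matrix.mul_neg, Matrix.neg_mul, zero_add, add_zero]
    at h3 h4 h5
  refine ⟨?_, ?_, ?_⟩
  · rw [← sub_eq_zero, sub_eq_add_neg]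
    simpa [add_comm] using congrArg Neg.neg h4
  · symm
    rw [← sub_eq_zero, sub_eq_add_neg]
    simpa using h5
  · rw [sub_eq_add_neg]
    exact h3

/-- Block elimination with pivot `D`. The symplectic relations make `D⁻¹ C` and `B D⁻¹` symmetric
and make the Schur complement `A - B D⁻¹ C` the inverse of `Dᵀ`. -/
theorem shear_mul_fromBlocks {A B C D : Matrix (Fin k) (Fin k) ℝ}
    (h : Matrix.fromBlocks A B C D ∈ Matrix.symplecticGroup (Fin k) ℝ) (hD : IsUnit D.det) :
    (-(D⁻¹ * C)).IsSymm ∧ (B * D⁻¹).IsSymm ∧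
    shear false (-(D⁻¹ * C)) * (Matrix.fromBlocks D.transpose 0 0 D⁻¹ * (shear true (B * D⁻¹) *
      Matrix.fromBlocks A B C D)) = 1 := by
  obtain ⟨h1, h2, h3⟩ := fromBlocks_symplectic h
  have hl : D⁻¹ * D = 1 := Matrix.nonsing_inv_mul _ hD
  have hr : D * D⁻¹ = 1 := Matrix.mul_nonsing_inv _ hD
  have hlt : D⁻¹.transpose * D.transpose = 1 := by
    rw [← Matrix.transpose_mul, hr, Matrix.transpose_one]
  have hrt : D.transpose * D⁻¹.transpose = 1 := by
    rw [← Matrix.transpose_mul, hl, Matrix.transpose_one]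
  have hC : (D⁻¹ * C).IsSymm := by
    rw [Matrix.IsSymm, Matrix.transpose_mul]
    calc C.transpose * D⁻¹.transpose = D⁻¹ * (D * C.transpose) * D⁻¹.transpose := by
          rw [← Matrix.mul_assoc, hl, Matrix.one_mul]
      _ = D⁻¹ * C := by
          rw [← h2, Matrix.mul_assoc, Matrix.mul_assoc, hrt, Matrix.mul_one]
  have hB : (B * D⁻¹).IsSymm := by
    rw [Matrix.IsSymm, Matrix.transpose_mul]
    calc D⁻¹.transpose * B.transpose = D⁻¹.transpose * (B.transpose * D) * D⁻¹ := by
          rw [Matrix.mul_assoc, Matrix.mul_assoc, hr, Matrix.mul_one]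
      _ = B * D⁻¹ := by
          rw [h1, ← Matrix.mul_assoc, hlt, Matrix.one_mul]
  have hDB : D.transpose * (B * D⁻¹) = B.transpose := by
    rw [← Matrix.mul_assoc, ← h1, Matrix.mul_assoc, hr, Matrix.mul_one]
  refine ⟨hC.neg, hB, ?_⟩
  have e1 : shear true (B * D⁻¹) * Matrix.fromBlocks A B C D =
      Matrix.fromBlocks (A - B * D⁻¹ * C) 0 C D := by
    simp [shear, Matrix.fromBlocks_multiply, Matrix.mul_assoc, hl, sub_eq_add_neg]
  have e2 : Matrix.fromBlocks D.transpose 0 0 D⁻¹ *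
      Matrix.fromBlocks (A - B * D⁻¹ * C) 0 C D = Matrix.fromBlocks 1 0 (D⁻¹ * C) 1 := by
    simp [Matrix.fromBlocks_multiply, Matrix.mul_sub, ← Matrix.mul_assoc, hl]
    rw [Matrix.mul_assoc D.transpose, hDB, h3]
  rw [e1, e2]
  simp [shear, Matrix.fromBlocks_multiply]

theorem isSymm_inv_mul {X Y : Matrix (Fin k) (Fin k) ℝ} (hX : X.IsSymm) (hY : Y.IsSymm) :
    ((1 + Y * X)⁻¹ * Y).IsSymm := by
  have ht : (1 + Y * X).transpose = 1 + X * Y := by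
    rw [Matrix.transpose_add, Matrix.transpose_mul, hX, hY, Matrix.transpose_one]
  rw [Matrix.IsSymm, Matrix.transpose_mul, Matrix.transpose_nonsing_inv, ht, hY]
  by_cases h : IsUnit (1 + Y * X).det
  · have h' : IsUnit (1 + X * Y).det := by rwa [← ht, Matrix.det_transpose]
    have e : Y * (1 + X * Y) = (1 + Y * X) * Y := by noncomm_ring
    calc Y * (1 + X * Y)⁻¹ = (1 + Y * X)⁻¹ * ((1 + Y * X) * Y) * (1 + X * Y)⁻¹ := by
          rw [← Matrix.mul_assoc, Matrix.nonsing_inv_mul _ h, Matrix.one_mul]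
      _ = (1 + Y * X)⁻¹ * Y := by
          rw [← e, Matrix.mul_assoc, Matrix.mul_assoc, Matrix.mul_nonsing_inv _ h', Matrix.mul_one]
  -- Both inverses are `0` by convention here, so the symmetry needs no invertibility hypothesis.
  · have h' : ¬ IsUnit (1 + X * Y).det := by rwa [← ht, Matrix.det_transpose]
    rw [Matrix.nonsing_inv_apply_not_isUnit _ h, Matrix.nonsing_inv_apply_not_isUnit _ h',
      Matrix.mul_zero, Matrix.zero_mul]

/-- Local factorisation into symmetric shears, with a parameter `s` that interpolates between a
trivial product and the inverse. -/
theorem exists_shear_factorization (k : ℕ) :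
    ∃ L : List (Bool × (ℝ × FibMat k → Matrix (Fin k) (Fin k) ℝ)),
      (∀ q ∈ L, ∀ s, ContDiffAt ℝ ω q.2 (s, 1) ∧ (q.2 (s, 1)).IsSymm) ∧
      (∀ s, (L.map fun q => shear q.1 (s • q.2 (s, 1))).prod = 1) ∧
      ∀ᶠ M in 𝓝 1, M ∈ Matrix.symplecticGroup (Fin k) ℝ →
        (∀ q ∈ L, (q.2 (1, M)).IsSymm) ∧
        (L.map fun q => shear q.1 (q.2 (1, M))).prod * M = 1 := by
  obtain ⟨X₁, X₂, h1, h2, h10, h20, hs1, hs2, hfac⟩ := exists_symm_factorization k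
  let b : FibMat k →L[ℝ] Matrix (Fin k) (Fin k) ℝ := LinearMap.toContinuousLinearMap
    { toFun := fun M => M.toBlocks₁₂, map_add' := fun _ _ => rfl, map_smul' := fun _ _ => rfl }
  let c : FibMat k →L[ℝ] Matrix (Fin k) (Fin k) ℝ := LinearMap.toContinuousLinearMap
    { toFun := fun M => M.toBlocks₂₁, map_add' := fun _ _ => rfl, map_smul' := fun _ _ => rfl }
  let d : FibMat k →L[ℝ] Matrix (Fin k) (Fin k) ℝ := LinearMap.toContinuousLinearMap
    { toFun := fun M => M.toBlocks₂₂, map_add' := fun _ _ => rfl, map_smul' := fun _ _ => rfl }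
  let dt : FibMat k →L[ℝ] Matrix (Fin k) (Fin k) ℝ := LinearMap.toContinuousLinearMap
    { toFun := fun M => M.toBlocks₂₂.transpose, map_add' := fun _ _ => rfl,
      map_smul' := fun _ _ => rfl }
  have hb1 : b 1 = 0 := by ext i j; simp [b, Matrix.toBlocks₁₂]
  have hc1 : c 1 = 0 := by ext i j; simp [c, Matrix.toBlocks₂₁]
  have hd1 : d 1 = 1 := by ext i j; simp [d, Matrix.toBlocks₂₂, Matrix.one_apply]
  have hdt1 : dt 1 = 1 := by
    ext i j; simp [dt, Matrix.toBlocks₂₂, Matrix.one_apply, eq_comm]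
  have inv_smooth : ∀ {f : ℝ × FibMat k → Matrix (Fin k) (Fin k) ℝ} {p : ℝ × FibMat k},
      ContDiffAt ℝ ω f p → f p = 1 → ContDiffAt ℝ ω (fun p => (f p)⁻¹) p := by
    intro f p hf hp
    simp only [Matrix.nonsing_inv_eq_ringInverse]
    have := contDiffAt_ringInverse ℝ (n := ω) (1 : (Matrix (Fin k) (Fin k) ℝ)ˣ)
    rw [Units.val_one, ← hp] at this
    exact this.comp p hf
  -- Scaled by `s = p.1`, these are the four parameters of `shear_mul_four` for `s X` and `s Y`,
  -- with `X` evaluated at `Dᵀ`.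
  let F (X : Matrix (Fin k) (Fin k) ℝ → Matrix (Fin k) (Fin k) ℝ) (Y : Matrix (Fin k) (Fin k) ℝ) :
      List (Bool × (ℝ × FibMat k → Matrix (Fin k) (Fin k) ℝ)) :=
    [(true, fun p => X (dt p.2) + p.1 ^ 2 • (X (dt p.2) * Y * X (dt p.2))),
     (false, fun p => -((1 + Y * (p.1 ^ 2 • X (dt p.2)))⁻¹ * Y)),
     (true, fun p => -X (dt p.2)), (false, fun _ => Y)]
  have hF : ∀ (X : Matrix (Fin k) (Fin k) ℝ → Matrix (Fin k) (Fin k) ℝ)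
      (Y : Matrix (Fin k) (Fin k) ℝ), ContDiffAt ℝ ω X 1 → X 1 = 0 →
      ∀ q ∈ F X Y, ∀ s, ContDiffAt ℝ ω q.2 (s, 1) := by
    intro X Y hX hX1 q hq s
    have hXd : ContDiffAt ℝ ω (fun p : ℝ × FibMat k => X (dt p.2)) (s, 1) := by
      have h' : ContDiffAt ℝ ω (fun p : ℝ × FibMat k => dt p.2) (s, 1) :=
        (dt.contDiff.comp contDiff_snd).contDiffAt
      refine ContDiffAt.comp (s, (1 : FibMat k)) ?_ h'
      simpa [hdt1] using hX
    have hs : ContDiffAt ℝ ω (fun p : ℝ × FibMat k => p.1 ^ 2) (s, 1) :=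
      (contDiff_fst.pow 2).contDiffAt
    simp only [F, List.mem_cons, List.not_mem_nil, or_false] at hq
    rcases hq with rfl | rfl | rfl | rfl
    · exact hXd.add (hs.smul ((hXd.mul contDiffAt_const).mul hXd))
    · refine ((inv_smooth ?_ ?_).mul contDiffAt_const).neg
      · exact contDiffAt_const.add (contDiffAt_const.mul (hs.smul hXd))
      · simp [hdt1, hX1]
    · exact hXd.neg
    · exact contDiffAt_const
  have hsymm : ∀ (X : Matrix (Fin k) (Fin k) ℝ → Matrix (Fin k) (Fin k) ℝ)
      (Y : Matrix (Fin k) (Fin k) ℝ), (∀ Q, (X Q).IsSymm) → Y.IsSymm →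
      ∀ q ∈ F X Y, ∀ s M, (q.2 (s, M)).IsSymm := by
    intro X Y hX hY q hq s M
    simp only [F, List.mem_cons, List.not_mem_nil, or_false] at hq
    rcases hq with rfl | rfl | rfl | rfl
    · refine (hX _).add (Matrix.IsSymm.smul ?_ _)
      rw [Matrix.IsSymm, Matrix.transpose_mul, Matrix.transpose_mul, hX, hY, Matrix.mul_assoc]
    · exact (isSymm_inv_mul ((hX _).smul _) hY).neg
    · exact (hX _).neg
    · exact hY
  have hprod0 : ∀ (X : Matrix (Fin k) (Fin k) ℝ → Matrix (Fin k) (Fin k) ℝ)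
      (Y : Matrix (Fin k) (Fin k) ℝ), X 1 = 0 → ∀ s : ℝ,
      ((F X Y).map fun q => shear q.1 (s • q.2 (s, 1))).prod = 1 := by
    intro X Y hX s
    -- At the identity matrix `X` vanishes, and the two remaining lower shears have the opposite
    -- parameters `-s Y` and `s Y`. The product is trivial although these factors need not be.
    simp [F, hdt1, hX, ← shear_add]
  have hprod : ∀ (X : Matrix (Fin k) (Fin k) ℝ → Matrix (Fin k) (Fin k) ℝ)
      (Y : Matrix (Fin k) (Fin k) ℝ) (M : FibMat k), IsUnit (1 + Y * X (dt M)).det →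
      ((F X Y).map fun q => shear q.1 (q.2 (1, M))).prod =
        Matrix.fromBlocks (1 + X (dt M) * Y) 0 0 (1 + Y * X (dt M))⁻¹ := by
    intro X Y M h
    rw [← shear_mul_four h]
    simp [F]
  have hΛ : (diagRange k).IsSymm := Matrix.isSymm_diagonal _
  -- The list spells out the inverse of `M`: a lower shear, `diag(Dᵀ, D⁻¹)` as two blocks of four
  -- shears, and an upper shear. The block for `1 + X₁` takes `Y = 1`, the one for `1 + X₂ Λ` takes
  -- `Y = Λ`.
  refine ⟨(false, fun p => -((d p.2)⁻¹ * c p.2)) :: (F X₁ 1 ++ (F X₂ (diagRange k) ++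
    [(true, fun p => b p.2 * (d p.2)⁻¹)])), ?_, ?_, ?_⟩
  · have hsm : ∀ (l : FibMat k →L[ℝ] Matrix (Fin k) (Fin k) ℝ) (s : ℝ),
        ContDiffAt ℝ ω (fun p : ℝ × FibMat k => l p.2) (s, 1) := fun l s =>
      (l.contDiff.comp contDiff_snd).contDiffAt
    intro q hq s
    simp only [List.mem_cons, List.mem_append, List.not_mem_nil, or_false] at hq
    rcases hq with rfl | hq | hq | rfl
    · refine ⟨((inv_smooth (hsm d s) hd1).mul (hsm c s)).neg, by simp [hc1]⟩
    · exact ⟨hF _ _ h1 h10 q hq s, hsymm _ _ hs1 Matrix.isSymm_one q hq s 1⟩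
    · exact ⟨hF _ _ h2 h20 q hq s, hsymm _ _ hs2 hΛ q hq s 1⟩
    · exact ⟨(hsm b s).mul (inv_smooth (hsm d s) hd1), by simp [hb1]⟩
  · intro s
    rw [List.map_cons, List.map_append, List.map_append, List.prod_cons, List.prod_append,
      List.prod_append, hprod0 _ _ h10, hprod0 _ _ h20]
    simp [hb1, hc1]
  · have ht : Tendsto dt (𝓝 1) (𝓝 1) := by
      have := dt.continuous.tendsto 1
      rwa [hdt1] at this
    have hdet : ∀ᶠ Q : Matrix (Fin k) (Fin k) ℝ in 𝓝 1, Q.det ≠ 0 := by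
      have : ContinuousAt (fun Q : Matrix (Fin k) (Fin k) ℝ => Q.det) 1 :=
        (continuous_id.matrix_det).continuousAt
      exact this.eventually_ne (by simp)
    filter_upwards [ht.eventually hfac, ht.eventually hdet] with M hM hMdet hMs
    have hdd : dt M = (d M).transpose := rfl
    have hD : IsUnit (d M).det := by
      have : (dt M).det ≠ 0 := hMdet
      rw [hdd, Matrix.det_transpose] at this
      exact isUnit_iff_ne_zero.2 this
    have hMb : M = Matrix.fromBlocks M.toBlocks₁₁ (b M) (c M) (d M) :=
      (Matrix.fromBlocks_toBlocks M).symm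
    -- Transposing the factorisation of `Dᵀ` reverses its order, which is the order in which the
    -- inverse lower-right blocks multiply to `D⁻¹`.
    have hM' : (1 + diagRange k * X₂ (dt M)) * (1 + 1 * X₁ (dt M)) = d M := by
      have := congrArg Matrix.transpose hM
      rw [hdd, Matrix.transpose_transpose, Matrix.transpose_mul, Matrix.transpose_add,
        Matrix.transpose_add, Matrix.transpose_mul, (hs1 _).eq, (hs2 _).eq, hΛ.eq,
        Matrix.transpose_one] at this
      rw [Matrix.one_mul]
      exact this
    have hu := hD
    rw [← hM', Matrix.det_mul, IsUnit.mul_iff] at hu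
    have hMs' := hMs
    rw [hMb] at hMs'
    obtain ⟨r1, r2, r3⟩ := shear_mul_fromBlocks hMs' hD
    refine ⟨?_, ?_⟩
    · intro q hq
      simp only [List.mem_cons, List.mem_append, List.not_mem_nil, or_false] at hq
      rcases hq with rfl | hq | hq | rfl
      · exact r1
      · exact hsymm _ _ hs1 Matrix.isSymm_one q hq 1 M
      · exact hsymm _ _ hs2 hΛ q hq 1 M
      · exact r2
    · rw [List.map_cons, List.map_append, List.map_append, List.prod_cons, List.prod_append,
        List.prod_append, hprod _ _ M hu.2, hprod _ _ M hu.1]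
      rw [← hMb] at r3
      rw [← r3]
      have hdiag : Matrix.fromBlocks (1 + X₁ (dt M) * 1) 0 0 (1 + 1 * X₁ (dt M))⁻¹ *
          Matrix.fromBlocks (1 + X₂ (dt M) * diagRange k) 0 0 (1 + diagRange k * X₂ (dt M))⁻¹ =
          Matrix.fromBlocks (d M).transpose 0 0 (d M)⁻¹ := by
        rw [Matrix.fromBlocks_multiply, ← Matrix.mul_inv_rev, hM', Matrix.mul_one, hM, hdd]
        simp
      rw [← hdiag]
      simp [Matrix.mul_assoc]

/-- Local factorisation into elementary shears. -/
theorem exists_elemShear_factorization (k : ℕ) :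
    ∃ L : List ((Bool × Fin k × Fin k) × (ℝ × FibMat k → ℝ)),
      (∀ q ∈ L, ∀ s, ContDiffAt ℝ ω q.2 (s, 1)) ∧
      (∀ s, (L.map fun q => elemShear q.1 (s * q.2 (s, 1))).prod = 1) ∧
      ∀ᶠ M in 𝓝 1, M ∈ Matrix.symplecticGroup (Fin k) ℝ →
        (L.map fun q => elemShear q.1 (q.2 (1, M))).prod * M = 1 := by
  obtain ⟨L, hL, hL1, hL2⟩ := exists_shear_factorization k
  let expand : Bool × (ℝ × FibMat k → Matrix (Fin k) (Fin k) ℝ) →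
      List ((Bool × Fin k × Fin k) × (ℝ × FibMat k → ℝ)) :=
    fun q => (Finset.univ : Finset (Fin k × Fin k)).toList.map fun p =>
      ((q.1, p), fun z => q.2 z p.1 p.2 / 2)
  have key : ∀ s r M, (∀ q ∈ L, (q.2 (s, M)).IsSymm) →
      ((L.flatMap expand).map fun q => elemShear q.1 (r * q.2 (s, M))).prod =
      (L.map fun q => shear q.1 (r • q.2 (s, M))).prod := by
    intro s r M h
    clear hL hL1 hL2
    induction L with
    | nil => simp
    | cons q L ih =>
      rw [List.flatMap_cons, List.map_append, List.prod_append, List.map_cons, List.prod_cons,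
        ih fun q' hq' => h q' (List.mem_cons_of_mem _ hq')]
      congr 1
      rw [shear_eq_prod_elemShear q.1 ((h q List.mem_cons_self).smul r)]
      simp only [expand, List.map_map]
      congr 2
      funext p
      simp [mul_div_assoc]
  refine ⟨L.flatMap expand, ?_, ?_, ?_⟩
  · intro q hq s
    obtain ⟨q', hq', hq⟩ := List.mem_flatMap.1 hq
    obtain ⟨p, -, rfl⟩ := List.mem_map.1 hq
    have h1 := (hL q' hq' s).1
    have h2 : ContDiff ℝ ω (fun M : Matrix (Fin k) (Fin k) ℝ => M p.1 p.2 / 2) :=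
      (Matrix.entryLinearMap ℝ ℝ p.1 p.2).toContinuousLinearMap.contDiff.div_const 2
    exact h2.contDiffAt.comp _ h1
  · intro s
    rw [key s s 1 fun q hq => (hL q hq s).2, hL1]
  · filter_upwards [hL2] with M hM hMs
    obtain ⟨h1, h2⟩ := hM hMs
    have := key 1 1 M h1
    simp only [one_mul, one_smul] at this
    rw [this, h2]

end Factorization

/-! ### Transvections of the bundle and the group they generate. -/

section BundleCalculus

theorem triv_snd_injective {F B : Type*} [TopologicalSpace F] [TopologicalSpace B]
    {V : B → Type*} [TopologicalSpace (TotalSpace F V)] [∀ x, AddCommGroup (V x)]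
    {e : Trivialization F (π F V)} {x : B} (hx : x ∈ e.baseSet) {u v : V x}
    (h : (e ⟨x, u⟩).2 = (e ⟨x, v⟩).2) : u = v := by
  rw [← e.symm_apply_apply_mk hx u, h, e.symm_apply_apply_mk hx]

variable {n k : ℕ} {X : Type*} [TopologicalSpace X] [ChartedSpace (EuclideanSpace ℝ (Fin n)) X]
  {V : X → Type*} [TopologicalSpace (TotalSpace (Fib k) V)]
  [∀ x, AddCommGroup (V x)] [∀ x, Module ℝ (V x)] [∀ x, TopologicalSpace (V x)]
  [FiberBundle (Fib k) V]

theorem stdForm_self (u : Fib k) : stdForm k u u = 0 := by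
  rw [stdForm_apply]
  exact Finset.sum_eq_zero fun i _ => by ring

theorem stdForm_swap (u v : Fib k) : stdForm k u v = -stdForm k v u := by
  rw [stdForm_apply, stdForm_apply, ← Finset.sum_neg_distrib]
  exact Finset.sum_congr rfl fun i _ => by ring

theorem SpStructure.form_self (σ : SpStructure n k V) {x : X} (u : V x) : σ.form x u u = 0 :=
  stdForm_self _

theorem SpStructure.form_swap (σ : SpStructure n k V) {x : X} (u v : V x) :
    σ.form x u v = -σ.form x v u :=
  stdForm_swap _ _

/-- The span of `v` and `w` is isotropic, so the transvection changes neither `ω(u, v)` nor `ω(u,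
w)`. Replacing `v` by `-v` therefore subtracts exactly what was added. -/
theorem SpStructure.transvection_neg_cancel (σ : SpStructure n k V) {x : X} {v w : V x}
    (h : σ.form x v w = 0) (u : V x) :
    (u + σ.form x u v • w + σ.form x u w • v) +
      σ.form x (u + σ.form x u v • w + σ.form x u w • v) ((-1 : ℝ) • v) • w +
      σ.form x (u + σ.form x u v • w + σ.form x u w • v) w • ((-1 : ℝ) • v) = u := by
  have h1 : σ.form x w v = 0 := by rw [σ.form_swap, h, neg_zero]
  have h2 : σ.form x (u + σ.form x u v • w + σ.form x u w • v) v = σ.form x u v := by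
    simp [h1, σ.form_self]
  have h3 : σ.form x (u + σ.form x u v • w + σ.form x u w • v) w = σ.form x u w := by
    simp [h, σ.form_self]
  rw [map_smul, h2, h3]
  module

/-- The linear map `u ↦ u + ω(u, v) w + ω(u, w) v` on a fibre, where `ω(v, w) = 0`. -/
noncomputable def SpStructure.transvectionEquiv (σ : SpStructure n k V) {x : X} {v w : V x}
    (h : σ.form x v w = 0) : V x ≃ₗ[ℝ] V x where
  toFun u := u + σ.form x u v • w + σ.form x u w • v
  map_add' a b := by simp only [map_add, LinearMap.add_apply]; module
  map_smul' c a := by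
    simp only [map_smul, LinearMap.smul_apply, smul_eq_mul, RingHom.id_apply]; module
  invFun u := u + σ.form x u ((-1 : ℝ) • v) • w + σ.form x u w • ((-1 : ℝ) • v)
  left_inv u := σ.transvection_neg_cancel h u
  right_inv u := by
    have h' : σ.form x ((-1 : ℝ) • v) w = 0 := by
      rw [map_smul, LinearMap.smul_apply, h, smul_zero]
    have := σ.transvection_neg_cancel h' u
    rwa [smul_smul (-1 : ℝ) (-1 : ℝ), neg_one_mul, neg_neg, one_smul] at this

theorem SpStructure.transvectionEquiv_symm_apply (σ : SpStructure n k V) {x : X} {v w : V x}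
    (h : σ.form x v w = 0) (u : V x) :
    (σ.transvectionEquiv h).symm u =
      u + σ.form x u ((-1 : ℝ) • v) • w + σ.form x u w • ((-1 : ℝ) • v) := rfl

namespace BundleAut

/-- The identity automorphism. -/
noncomputable def one : BundleAut n k V where
  fib x := LinearEquiv.refl ℝ (V x)
  contMDiff_toFun := contMDiff_id
  contMDiff_invFun := contMDiff_id

/-- The composition `E ∘ F`. -/
noncomputable def comp (E F : BundleAut n k V) : BundleAut n k V where
  fib x := E.fib x * F.fib x
  contMDiff_toFun := E.contMDiff_toFun.comp F.contMDiff_toFun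
  contMDiff_invFun := F.contMDiff_invFun.comp E.contMDiff_invFun

/-- The inverse automorphism. -/
noncomputable def inv (E : BundleAut n k V) : BundleAut n k V where
  fib x := (E.fib x)⁻¹
  contMDiff_toFun := E.contMDiff_invFun
  contMDiff_invFun := E.contMDiff_toFun

@[simp] theorem one_fib (x : X) : (one : BundleAut n k V).fib x = 1 := rfl

@[simp] theorem comp_fib (E F : BundleAut n k V) (x : X) :
    (E.comp F).fib x = E.fib x * F.fib x := rfl

@[simp] theorem inv_fib (E : BundleAut n k V) (x : X) : E.inv.fib x = (E.fib x)⁻¹ := rfl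

theorem IsSymplectic.comp {σ : SpStructure n k V} {E F : BundleAut n k V}
    (hE : E.IsSymplectic σ) (hF : F.IsSymplectic σ) : (E.comp F).IsSymplectic σ :=
  fun x u v => (hE x _ _).trans (hF x u v)

theorem IsSymplectic.inv {σ : SpStructure n k V} {E : BundleAut n k V}
    (hE : E.IsSymplectic σ) : E.inv.IsSymplectic σ := by
  intro x u v
  rw [← hE x]
  simp

/-- The action of an automorphism on the total space. -/
def totalMap (E : BundleAut n k V) (p : TotalSpace (Fib k) V) : TotalSpace (Fib k) V :=
  ⟨p.1, E.fib p.1 p.2⟩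

end BundleAut

/-- Members of `σ.trivs` need not lie in the atlas of the bundle; their own recorded smoothness
allows smoothness to be checked in their coordinates. -/
theorem contMDiffAt_of_triv {σ : SpStructure n k V} {e : Trivialization (Fib k) (π (Fib k) V)}
    (he : e ∈ σ.trivs) {E : Type*} [NormedAddCommGroup E] [NormedSpace ℝ E] {H : Type*}
    [TopologicalSpace H] {J : ModelWithCorners ℝ E H} {M : Type*} [TopologicalSpace M]
    [ChartedSpace H M] {f : M → TotalSpace (Fib k) V} {m : M}
    (hs : ∀ᶠ m' in 𝓝 m, (f m').proj ∈ e.baseSet)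
    (h1 : ContMDiffAt J (𝓡 n) ∞ (fun m' => (f m').proj) m)
    (h2 : ContMDiffAt J 𝓘(ℝ, Fib k) ∞ (fun m' => (e (f m')).2) m) :
    ContMDiffAt J ((𝓡 n).prod 𝓘(ℝ, Fib k)) ∞ f m := by
  have ht : ((f m).proj, (e (f m)).2) ∈ e.target := e.mem_target.2 hs.self_of_nhds
  have h3 := ((σ.contMDiffOn_symm e he).contMDiffAt (e.open_target.mem_nhds ht)).comp m
    (h1.prodMk h2)
  refine h3.congr_of_eventuallyEq ?_
  filter_upwards [hs] with m' hm'
  exact (e.symm_apply_mk_proj (e.mem_source.2 hm')).symm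

theorem contMDiffAt_triv_snd {σ : SpStructure n k V} {e : Trivialization (Fib k) (π (Fib k) V)}
    (he : e ∈ σ.trivs) {E : Type*} [NormedAddCommGroup E] [NormedSpace ℝ E] {H : Type*}
    [TopologicalSpace H] {J : ModelWithCorners ℝ E H} {M : Type*} [TopologicalSpace M]
    [ChartedSpace H M] {f : M → TotalSpace (Fib k) V} {m : M}
    (hs : (f m).proj ∈ e.baseSet)
    (hf : ContMDiffAt J ((𝓡 n).prod 𝓘(ℝ, Fib k)) ∞ f m) :
    ContMDiffAt J 𝓘(ℝ, Fib k) ∞ (fun m' => (e (f m')).2) m :=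
  (((σ.contMDiffOn_toFun e he).contMDiffAt (e.open_source.mem_nhds (e.mem_source.2 hs))).comp m
    hf).snd

section Coordinates

variable {σ : SpStructure n k V} {e : Trivialization (Fib k) (π (Fib k) V)}

theorem SpStructure.triv_add (he : e ∈ σ.trivs) {x : X} (hx : x ∈ e.baseSet) (u v : V x) :
    (e ⟨x, u + v⟩).2 = (e ⟨x, u⟩).2 + (e ⟨x, v⟩).2 :=
  haveI := σ.isLinear e he
  (e.linear ℝ hx).map_add u v

theorem SpStructure.triv_smul (he : e ∈ σ.trivs) {x : X} (hx : x ∈ e.baseSet) (c : ℝ) (u : V x) :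
    (e ⟨x, c • u⟩).2 = c • (e ⟨x, u⟩).2 :=
  haveI := σ.isLinear e he
  (e.linear ℝ hx).map_smul c u

end Coordinates

theorem contDiff_transvection (k : ℕ) : ContDiff ℝ ∞ (fun p : Fib k × Fib k × Fib k =>
    p.1 + stdForm k p.1 p.2.1 • p.2.2 + stdForm k p.1 p.2.2 • p.2.1) := by
  simp only [stdForm_apply]
  fun_prop

theorem contMDiff_transvection (σ : SpStructure n k V) {v w : ∀ x, V x}
    (hv : ContMDiff (𝓡 n) ((𝓡 n).prod 𝓘(ℝ, Fib k)) ∞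
      (fun x => (⟨x, v x⟩ : TotalSpace (Fib k) V)))
    (hw : ContMDiff (𝓡 n) ((𝓡 n).prod 𝓘(ℝ, Fib k)) ∞
      (fun x => (⟨x, w x⟩ : TotalSpace (Fib k) V))) :
    ContMDiff ((𝓡 n).prod 𝓘(ℝ, Fib k)) ((𝓡 n).prod 𝓘(ℝ, Fib k)) ∞
      (fun p : TotalSpace (Fib k) V => (⟨p.1, p.2 + σ.form p.1 p.2 (v p.1) • w p.1 +
        σ.form p.1 p.2 (w p.1) • v p.1⟩ : TotalSpace (Fib k) V)) := by
  intro p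
  obtain ⟨e, he, hp⟩ := σ.cover p.1
  have hproj : ContMDiffAt ((𝓡 n).prod 𝓘(ℝ, Fib k)) (𝓡 n) ∞
    (fun p : TotalSpace (Fib k) V => p.proj) p := contMDiffAt_proj V
  have hs : ∀ᶠ q : TotalSpace (Fib k) V in 𝓝 p, q.proj ∈ e.baseSet :=
    hproj.continuousAt.eventually (e.open_baseSet.mem_nhds hp)
  refine contMDiffAt_of_triv he hs hproj ?_
  have h1 : ContMDiffAt ((𝓡 n).prod 𝓘(ℝ, Fib k)) 𝓘(ℝ, Fib k) ∞
    (fun q : TotalSpace (Fib k) V => (e q).2) p := contMDiffAt_triv_snd he hp contMDiffAt_id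
  have hv' : ContMDiffAt ((𝓡 n).prod 𝓘(ℝ, Fib k)) 𝓘(ℝ, Fib k) ∞
      (fun q : TotalSpace (Fib k) V => (e ⟨q.proj, v q.proj⟩).2) p :=
    contMDiffAt_triv_snd he (f := fun q : TotalSpace (Fib k) V => ⟨q.proj, v q.proj⟩) hp
      (hv.contMDiffAt.comp p hproj)
  have hw' : ContMDiffAt ((𝓡 n).prod 𝓘(ℝ, Fib k)) 𝓘(ℝ, Fib k) ∞
      (fun q : TotalSpace (Fib k) V => (e ⟨q.proj, w q.proj⟩).2) p :=
    contMDiffAt_triv_snd he (f := fun q : TotalSpace (Fib k) V => ⟨q.proj, w q.proj⟩) hp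
      (hw.contMDiffAt.comp p hproj)
  have h := (contDiff_transvection k).contMDiff.contMDiffAt.comp p
    (h1.prodMk_space (hv'.prodMk_space hw'))
  refine h.congr_of_eventuallyEq ?_
  filter_upwards [hs] with q hq
  simp only [Function.comp]
  rw [σ.triv_add he hq, σ.triv_add he hq, σ.triv_smul he hq, σ.triv_smul he hq,
    σ.form_eq he hq, σ.form_eq he hq]

theorem contMDiff_smul_section (σ : SpStructure n k V) (c : ℝ) {v : ∀ x, V x}
    (hv : ContMDiff (𝓡 n) ((𝓡 n).prod 𝓘(ℝ, Fib k)) ∞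
      (fun x => (⟨x, v x⟩ : TotalSpace (Fib k) V))) :
    ContMDiff (𝓡 n) ((𝓡 n).prod 𝓘(ℝ, Fib k)) ∞
      (fun x => (⟨x, c • v x⟩ : TotalSpace (Fib k) V)) := by
  intro x
  obtain ⟨e, he, hx⟩ := σ.cover x
  have hs : ∀ᶠ y in 𝓝 x, y ∈ e.baseSet := e.open_baseSet.mem_nhds hx
  refine contMDiffAt_of_triv he hs contMDiffAt_id ?_
  have h := (contDiff_const_smul (n := ∞) (𝕜 := ℝ) (F := Fib k) c).contMDiff.contMDiffAt.comp x
    (contMDiffAt_triv_snd he (f := fun x => ⟨x, v x⟩) hx hv.contMDiffAt)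
  refine h.congr_of_eventuallyEq ?_
  filter_upwards [hs] with y hy
  exact σ.triv_smul he hy c _

namespace BundleAut

/-- The automorphism `u ↦ u + ω(u, v) w + ω(u, w) v` for smooth sections with `ω(v, w) = 0`. -/
noncomputable def transvection (σ : SpStructure n k V) (v w : ∀ x, V x)
    (hv : ContMDiff (𝓡 n) ((𝓡 n).prod 𝓘(ℝ, Fib k)) ∞
      (fun x => (⟨x, v x⟩ : TotalSpace (Fib k) V)))
    (hw : ContMDiff (𝓡 n) ((𝓡 n).prod 𝓘(ℝ, Fib k)) ∞
      (fun x => (⟨x, w x⟩ : TotalSpace (Fib k) V)))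
    (h : ∀ x, σ.form x (v x) (w x) = 0) : BundleAut n k V where
  fib x := σ.transvectionEquiv (h x)
  contMDiff_toFun := contMDiff_transvection σ hv hw
  contMDiff_invFun := by
    simp only [SpStructure.transvectionEquiv_symm_apply]
    have hv' := contMDiff_smul_section σ (-1) hv
    have := contMDiff_transvection σ (v := fun x => (-1 : ℝ) • v x) (w := w) hv' hw
    exact this

/-- `E` is a transvection `u ↦ u + ω(u, v) w + ω(u, w) v`, where `v` and `w` respect the splitting
if the bundle is Lagrangian. -/
def IsTransvection (σ : SpStructure n k V) (E : BundleAut n k V) : Prop :=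
  ∃ v w : ∀ x, V x,
    ContMDiff (𝓡 n) ((𝓡 n).prod 𝓘(ℝ, Fib k)) ∞
      (fun x => (⟨x, v x⟩ : TotalSpace (Fib k) V)) ∧
    ContMDiff (𝓡 n) ((𝓡 n).prod 𝓘(ℝ, Fib k)) ∞
      (fun x => (⟨x, w x⟩ : TotalSpace (Fib k) V)) ∧
    (∀ x, σ.form x (v x) (w x) = 0) ∧
    (∀ x (u : V x), E.fib x u = u + σ.form x u (v x) • w x + σ.form x u (w x) • v x) ∧
    (σ.IsLagrangian →
      (∀ x, v x ∈ σ.L₁ x ∧ w x ∈ σ.L₁ x) ∨ (∀ x, v x ∈ σ.L₂ x ∧ w x ∈ σ.L₂ x))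

namespace IsTransvection

variable {σ : SpStructure n k V} {E : BundleAut n k V}

theorem respectsSplitting (h : E.IsTransvection σ) (hσ : σ.IsLagrangian) :
    E.RespectsSplitting σ := by
  obtain ⟨v, w, hv, hw, hvw, hE, hL⟩ := h
  exact ⟨v, w, hv, hw, hvw, hE, hL hσ⟩

theorem isSymplectic (h : E.IsTransvection σ) : E.IsSymplectic σ := by
  obtain ⟨v, w, -, -, hvw, hE, -⟩ := h
  intro x a b
  have h1 := σ.form_swap (w x) (v x)
  have h2 := σ.form_swap (v x) b
  have h3 := σ.form_swap (w x) b
  simp only [hE, map_add, map_smul, LinearMap.add_apply, LinearMap.smul_apply, smul_eq_mul, h1, h2,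
    h3, hvw, σ.form_self]
  ring

/-- `E - id` has its range in the span of `v` and `w`, and it kills that span because the span is
isotropic. -/
theorem isElementaryFactor (h : E.IsTransvection σ) : E.IsElementaryFactor σ := by
  have hs := h.isSymplectic
  obtain ⟨v, w, -, -, hvw, hE, -⟩ := h
  have hsub : ∀ x u, E.subId x u = σ.form x u (v x) • w x + σ.form x u (w x) • v x := by
    intro x u
    simp [subId, hE, add_assoc]
  have hsq : ∀ x, E.subId x ^ 2 = 0 := by
    intro x
    refine LinearMap.ext fun u => ?_
    have h1 := σ.form_swap (w x) (v x)
    rw [pow_two, Module.End.mul_apply, hsub, hsub]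
    simp [h1, hvw, σ.form_self]
  refine ⟨hs, fun x => ⟨2, hsq x⟩, fun x => ⟨hsq x, ?_⟩⟩
  have hr : LinearMap.range (E.subId x) ≤ Submodule.span ℝ {v x, w x} := by
    rintro _ ⟨u, rfl⟩
    rw [hsub]
    exact add_mem (Submodule.smul_mem _ _ (Submodule.subset_span (by simp)))
      (Submodule.smul_mem _ _ (Submodule.subset_span (by simp)))
  refine (Submodule.rank_mono hr).trans ((rank_span_le _).trans ?_)
  refine (Cardinal.mk_insert_le).trans ?_
  rw [Cardinal.mk_singleton, one_add_one_eq_two]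

theorem inv (h : E.IsTransvection σ) : E.inv.IsTransvection σ := by
  obtain ⟨v, w, hv, hw, hvw, hE, hL⟩ := h
  refine ⟨fun x => (-1 : ℝ) • v x, w, contMDiff_smul_section σ (-1) hv, hw, ?_, ?_, ?_⟩
  · intro x
    simp [hvw]
  · intro x u
    have hfib : E.fib x = σ.transvectionEquiv (hvw x) := LinearEquiv.ext fun u => hE x u
    rw [inv_fib, hfib]
    exact σ.transvectionEquiv_symm_apply (hvw x) u
  · intro hσ
    exact (hL hσ).imp (fun h x => ⟨Submodule.smul_mem _ _ (h x).1, (h x).2⟩)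
      (fun h x => ⟨Submodule.smul_mem _ _ (h x).1, (h x).2⟩)

end IsTransvection

/-- `T` is a finite composition of transvections. -/
def IsFactorable (σ : SpStructure n k V) (T : BundleAut n k V) : Prop :=
  ∃ E : List (BundleAut n k V), T.IsComposition E ∧ ∀ F ∈ E, F.IsTransvection σ

namespace IsFactorable

variable {σ : SpStructure n k V} {S T : BundleAut n k V}

theorem of_fib_eq_one (h : ∀ x, T.fib x = 1) : T.IsFactorable σ :=
  ⟨[], fun x => by simp [h], by simp⟩

theorem congr (hS : S.IsFactorable σ) (h : ∀ x, T.fib x = S.fib x) : T.IsFactorable σ := by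
  obtain ⟨E, hE, hF⟩ := hS
  exact ⟨E, fun x => (h x).trans (hE x), hF⟩

theorem comp (hS : S.IsFactorable σ) (hT : T.IsFactorable σ) : (S.comp T).IsFactorable σ := by
  obtain ⟨E, hE, hE'⟩ := hS
  obtain ⟨F, hF, hF'⟩ := hT
  refine ⟨E ++ F, fun x => ?_, fun A hA => ?_⟩
  · rw [comp_fib, hE x, hF x, List.map_append, List.prod_append]
  · exact (List.mem_append.1 hA).elim (hE' A) (hF' A)

theorem inv (hS : S.IsFactorable σ) : S.inv.IsFactorable σ := by
  obtain ⟨E, hE, hE'⟩ := hS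
  refine ⟨(E.map BundleAut.inv).reverse, fun x => ?_, fun A hA => ?_⟩
  · rw [inv_fib, hE x, List.prod_inv_reverse, List.map_reverse, List.map_map, List.map_map]
    rfl
  · obtain ⟨B, hB, rfl⟩ := List.mem_map.1 (List.mem_reverse.1 hA)
    exact (hE' B hB).inv

theorem of_isTransvection (hT : T.IsTransvection σ) : T.IsFactorable σ :=
  ⟨[T], fun x => by simp, by simpa using hT⟩

theorem isSymplectic (hT : T.IsFactorable σ) : T.IsSymplectic σ := by
  obtain ⟨E, hE, hE'⟩ := hT
  intro x
  rw [hE x]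
  clear hE
  induction E with
  | nil => simp
  | cons A E ih =>
    intro u v
    rw [List.map_cons, List.prod_cons, LinearEquiv.mul_apply, LinearEquiv.mul_apply,
      (hE' A List.mem_cons_self).isSymplectic x]
    exact ih (fun F hF => hE' F (List.mem_cons_of_mem _ hF)) u v

end IsFactorable

end BundleAut

end BundleCalculus

/-! ### Elementary shears, cut off and extended to the whole bundle. -/

section LocalFactors

variable {n k : ℕ} {X : Type*} [TopologicalSpace X] [ChartedSpace (EuclideanSpace ℝ (Fin n)) X]
  {V : X → Type*} [TopologicalSpace (TotalSpace (Fib k) V)]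
  [∀ x, AddCommGroup (V x)] [∀ x, Module ℝ (V x)] [∀ x, TopologicalSpace (V x)]
  [FiberBundle (Fib k) V]

/-- The standard basis vector `e_a` of the first (for `true`) or second (for `false`) summand. -/
def basisVec (s : Bool) (a : Fin k) : Fib k :=
  Pi.single (if s then Sum.inl a else Sum.inr a) 1

theorem stdForm_basisVec (s : Bool) (a b : Fin k) :
    stdForm k (basisVec s a) (basisVec s b) = 0 := by
  cases s <;> simp [stdForm_apply, basisVec]

/-- Pairing `y` with a basis vector gives `-y (inr c)` or `y (inl c)` according to the summand; the
minus sign in `shear true` makes one transvection formula cover both types. -/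
theorem elemShear_mulVec (s : Bool) (a b : Fin k) (t : ℝ) (y : Fib k) :
    (elemShear (s, a, b) t).mulVec y = y + (t * stdForm k y (basisVec s a)) • basisVec s b +
      (t * stdForm k y (basisVec s b)) • basisVec s a := by
  have hs : ∀ (c d : Fin k) (z : Fin k → ℝ),
      (Matrix.single c d t).mulVec z = Pi.single c (t * z d) := fun c d z =>
    Matrix.single_mulVec c d t z
  have h1 : ∀ c, stdForm k y (basisVec true c) = -y (Sum.inr c) := fun c => by
    simp [stdForm_apply, basisVec, Pi.single_apply]
  have h2 : ∀ c, stdForm k y (basisVec false c) = y (Sum.inl c) := fun c => by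
    simp [stdForm_apply, basisVec, Pi.single_apply]
  cases s
  · rw [h2, h2]
    ext (i | i)
    · simp [elemShear, shear, basisVec, Matrix.fromBlocks_mulVec]
    · simp [elemShear, shear, Matrix.fromBlocks_mulVec, Matrix.add_mulVec, hs, basisVec,
        Pi.single_apply]
      ring
  · rw [h1, h1]
    ext (i | i)
    · simp [elemShear, shear, Matrix.fromBlocks_mulVec, Matrix.add_mulVec, Matrix.neg_mulVec, hs,
        basisVec, Pi.single_apply]
      split_ifs <;> ring
    · simp [elemShear, shear, basisVec, Matrix.fromBlocks_mulVec]

theorem SpStructure.triv_zero {σ : SpStructure n k V}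
    {e : Trivialization (Fib k) (π (Fib k) V)} (he : e ∈ σ.trivs) {x : X} (hx : x ∈ e.baseSet) :
    (e ⟨x, 0⟩).2 = 0 := by
  have := σ.triv_smul he hx 0 (0 : V x)
  rwa [zero_smul, zero_smul] at this

/-- Off the support of `χ` the section is locally zero, so the behaviour of `φ` and `e.symm` there
is irrelevant. -/
theorem contMDiff_localSection {σ : SpStructure n k V}
    {e : Trivialization (Fib k) (π (Fib k) V)} (he : e ∈ σ.trivs) {χ : X → ℝ}
    (hχ : tsupport χ ⊆ e.baseSet) (φ : X → ℝ)
    (hφ : ∀ x ∈ tsupport χ, ContMDiffAt (𝓡 n) 𝓘(ℝ, ℝ) ∞ (fun x => χ x * φ x) x) (y : Fib k) :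
    ContMDiff (𝓡 n) ((𝓡 n).prod 𝓘(ℝ, Fib k)) ∞
      (fun x => (⟨x, (χ x * φ x) • e.symm x y⟩ : TotalSpace (Fib k) V)) := by
  intro x
  by_cases hx : x ∈ tsupport χ
  · have hs : ∀ᶠ z in 𝓝 x, z ∈ e.baseSet := e.open_baseSet.mem_nhds (hχ hx)
    refine contMDiffAt_of_triv he hs contMDiffAt_id ?_
    have h : ContMDiffAt (𝓡 n) 𝓘(ℝ, Fib k) ∞ (fun x => (χ x * φ x) • y) x :=
      (hφ x hx).smul contMDiffAt_const
    refine h.congr_of_eventuallyEq ?_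
    filter_upwards [hs] with z hz
    rw [σ.triv_smul he hz, e.apply_mk_symm hz]
  · obtain ⟨e', he', hx'⟩ := σ.cover x
    have hs : ∀ᶠ z in 𝓝 x, z ∈ e'.baseSet := e'.open_baseSet.mem_nhds hx'
    refine contMDiffAt_of_triv he' hs contMDiffAt_id ?_
    have h : ContMDiffAt (𝓡 n) 𝓘(ℝ, Fib k) ∞ (fun _ => (0 : Fib k)) x := contMDiffAt_const
    refine h.congr_of_eventuallyEq ?_
    filter_upwards [hs, (isClosed_tsupport χ).isOpen_compl.mem_nhds hx] with z hz hz'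
    rw [image_eq_zero_of_notMem_tsupport hz', zero_mul, zero_smul, σ.triv_zero he' hz]

/-- An elementary shear in a trivialisation, cut off by `χ`, is a transvection of the bundle. -/
theorem exists_isTransvection_elemShear {σ : SpStructure n k V}
    {e : Trivialization (Fib k) (π (Fib k) V)} (he : e ∈ σ.trivs) {χ : X → ℝ}
    (hχs : ContMDiff (𝓡 n) 𝓘(ℝ, ℝ) ∞ χ)
    (hχ : tsupport χ ⊆ e.baseSet) (φ : X → ℝ)
    (hφ : ∀ x ∈ tsupport χ, ContMDiffAt (𝓡 n) 𝓘(ℝ, ℝ) ∞ φ x) (g : Bool × Fin k × Fin k) :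
    ∃ E : BundleAut n k V, E.IsTransvection σ ∧
      (∀ x ∈ e.baseSet, ∀ u : V x,
        (e ⟨x, E.fib x u⟩).2 = (elemShear g (χ x ^ 2 * φ x)).mulVec (e ⟨x, u⟩).2) ∧
      (∀ x, χ x = 0 → E.fib x = 1) := by
  obtain ⟨s, a, b⟩ := g
  -- Both sections need the cutoff in order to be global, while `φ` is put into one of them only;
  -- hence the shear parameter `χ² φ`.
  have hv := contMDiff_localSection he hχ φ (fun x hx => hχs.contMDiffAt.mul (hφ x hx))
    (basisVec s a)
  have hw := contMDiff_localSection he hχ (fun _ => 1)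
    (fun x _ => hχs.contMDiffAt.mul contMDiffAt_const) (basisVec s b)
  have h0 : ∀ x, χ x = 0 ∨ x ∈ e.baseSet := fun x => by
    by_cases hx : x ∈ tsupport χ
    · exact Or.inr (hχ hx)
    · exact Or.inl (image_eq_zero_of_notMem_tsupport hx)
  have hvw : ∀ x, σ.form x ((χ x * φ x) • e.symm x (basisVec s a))
      ((χ x * 1) • e.symm x (basisVec s b)) = 0 := by
    intro x
    rcases h0 x with hx | hx
    · simp [hx]
    · simp [σ.form_eq he hx, e.apply_mk_symm hx, stdForm_basisVec]
  refine ⟨BundleAut.transvection σ _ _ hv hw hvw, ⟨_, _, hv, hw, hvw, fun x u => rfl, ?_⟩, ?_, ?_⟩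
  · intro hσ
    cases s
    · refine Or.inr fun x => ?_
      rcases h0 x with hx | hx
      · simp [hx]
      · refine ⟨Submodule.smul_mem _ _ ?_, Submodule.smul_mem _ _ ?_⟩ <;>
        · rw [σ.mem_L₂_iff hσ he hx, e.apply_mk_symm hx]
          simp [basisVec]
    · refine Or.inl fun x => ?_
      rcases h0 x with hx | hx
      · simp [hx]
      · refine ⟨Submodule.smul_mem _ _ ?_, Submodule.smul_mem _ _ ?_⟩ <;>
        · rw [σ.mem_L₁_iff hσ he hx, e.apply_mk_symm hx]
          simp [basisVec]
  · intro x hx u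
    change (e ⟨x, u + σ.form x u ((χ x * φ x) • e.symm x (basisVec s a)) •
      ((χ x * 1) • e.symm x (basisVec s b)) + σ.form x u ((χ x * 1) • e.symm x (basisVec s b)) •
      ((χ x * φ x) • e.symm x (basisVec s a))⟩).2 = _
    rw [elemShear_mulVec, σ.triv_add he hx, σ.triv_add he hx]
    simp only [σ.triv_smul he hx, σ.form_eq he hx, e.apply_mk_symm hx, map_smul, smul_eq_mul]
    module
  · intro x hx
    refine LinearEquiv.ext fun u => ?_
    change u + σ.form x u ((χ x * φ x) • e.symm x (basisVec s a)) •
      ((χ x * 1) • e.symm x (basisVec s b)) + σ.form x u ((χ x * 1) • e.symm x (basisVec s b)) •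
      ((χ x * φ x) • e.symm x (basisVec s a)) = u
    simp [hx]

theorem exists_isFactorable_elemShear {σ : SpStructure n k V}
    {e : Trivialization (Fib k) (π (Fib k) V)} (he : e ∈ σ.trivs) {χ : X → ℝ}
    (hχs : ContMDiff (𝓡 n) 𝓘(ℝ, ℝ) ∞ χ) (hχ : tsupport χ ⊆ e.baseSet)
    {α : Type*} (g : α → Bool × Fin k × Fin k) (φ : α → X → ℝ) (L : List α)
    (hφ : ∀ q ∈ L, ∀ x ∈ tsupport χ, ContMDiffAt (𝓡 n) 𝓘(ℝ, ℝ) ∞ (φ q) x) :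
    ∃ E : BundleAut n k V, E.IsFactorable σ ∧
      (∀ x ∈ e.baseSet, ∀ u : V x,
        (e ⟨x, E.fib x u⟩).2 =
          ((L.map fun q => elemShear (g q) (χ x ^ 2 * φ q x)).prod).mulVec (e ⟨x, u⟩).2) ∧
      (∀ x, χ x = 0 → E.fib x = 1) := by
  induction L with
  | nil => exact ⟨BundleAut.one, BundleAut.IsFactorable.of_fib_eq_one fun _ => rfl,
      by simp, fun _ _ => rfl⟩
  | cons q L ih =>
    obtain ⟨E, hE, hE1, hE2⟩ := ih fun q' hq' => hφ q' (List.mem_cons_of_mem _ hq')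
    obtain ⟨F, hF, hF1, hF2⟩ := exists_isTransvection_elemShear he hχs hχ (φ q)
      (hφ q List.mem_cons_self) (g q)
    refine ⟨F.comp E, (BundleAut.IsFactorable.of_isTransvection hF).comp hE, ?_, ?_⟩
    · intro x hx u
      rw [List.map_cons, List.prod_cons, ← Matrix.mulVec_mulVec, ← hE1 x hx, ← hF1 x hx]
      rfl
    · intro x hx
      rw [BundleAut.comp_fib, hE2 x hx, hF2 x hx, one_mul]

end LocalFactors

/-! ### Matrices of automorphisms in a trivialisation. -/

section FibreMatrices

variable {n k : ℕ} {X : Type*} [TopologicalSpace X] [ChartedSpace (EuclideanSpace ℝ (Fin n)) X]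
  {V : X → Type*} [TopologicalSpace (TotalSpace (Fib k) V)]
  [∀ x, AddCommGroup (V x)] [∀ x, Module ℝ (V x)] [∀ x, TopologicalSpace (V x)]
  [FiberBundle (Fib k) V]

/-- The matrix of an automorphism in a trivialisation. -/
noncomputable def BundleAut.fibMatrix (e : Trivialization (Fib k) (π (Fib k) V))
    (T : BundleAut n k V) (x : X) : FibMat k :=
  Matrix.of fun i j => (e ⟨x, T.fib x (e.symm x (Pi.single j 1))⟩).2 i

variable {σ : SpStructure n k V} {e : Trivialization (Fib k) (π (Fib k) V)}

theorem BundleAut.fibMatrix_mulVec (he : e ∈ σ.trivs) (T : BundleAut n k V) {x : X}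
    (hx : x ∈ e.baseSet) (u : V x) :
    (T.fibMatrix e x).mulVec (e ⟨x, u⟩).2 = (e ⟨x, T.fib x u⟩).2 := by
  have := σ.isLinear e he
  let ℓ := e.linearEquivAt ℝ x hx
  have h : T.fibMatrix e x =
      LinearMap.toMatrix' (ℓ.toLinearMap ∘ₗ (T.fib x).toLinearMap ∘ₗ ℓ.symm.toLinearMap) := by
    ext i j
    rw [LinearMap.toMatrix'_apply]
    rfl
  rw [h, LinearMap.toMatrix'_mulVec]
  change ℓ (T.fib x (ℓ.symm (ℓ u))) = ℓ (T.fib x u)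
  rw [ℓ.symm_apply_apply]

theorem BundleAut.fibMatrix_mem_symplecticGroup (he : e ∈ σ.trivs) {T : BundleAut n k V}
    (hT : T.IsSymplectic σ) {x : X} (hx : x ∈ e.baseSet) :
    T.fibMatrix e x ∈ Matrix.symplecticGroup (Fin k) ℝ := by
  have h : ∀ y z : Fib k, stdForm k ((T.fibMatrix e x).mulVec y) ((T.fibMatrix e x).mulVec z) =
      stdForm k y z := by
    intro y z
    have hy : (e ⟨x, e.symm x y⟩).2 = y := by rw [e.apply_mk_symm hx]
    have hz : (e ⟨x, e.symm x z⟩).2 = z := by rw [e.apply_mk_symm hx]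
    rw [← hy, ← hz, T.fibMatrix_mulVec he hx, T.fibMatrix_mulVec he hx, ← σ.form_eq he hx,
      ← σ.form_eq he hx]
    exact hT x _ _
  rw [SymplecticGroup.mem_iff', ← neg_inj]
  refine (Matrix.toBilin' (R₁ := ℝ)).injective (LinearMap.ext₂ fun y z => ?_)
  have := h y z
  rw [stdForm, Matrix.toBilin'_apply', Matrix.toBilin'_apply', ← Matrix.vecMul_transpose,
    ← Matrix.dotProduct_mulVec, Matrix.mulVec_mulVec, Matrix.mulVec_mulVec] at this
  rw [Matrix.toBilin'_apply', Matrix.toBilin'_apply', ← this]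
  simp

theorem BundleAut.contMDiffAt_fibMatrix (he : e ∈ σ.trivs) (T : BundleAut n k V) {x : X}
    (hx : x ∈ e.baseSet) :
    ContMDiffAt (𝓡 n) 𝓘(ℝ, Fin k ⊕ Fin k → Fin k ⊕ Fin k → ℝ) ∞
      (fun z i j => T.fibMatrix e z i j) x := by
  have hs : ∀ᶠ z in 𝓝 x, z ∈ e.baseSet := e.open_baseSet.mem_nhds hx
  have hcol : ∀ y : Fib k, ContMDiffAt (𝓡 n) 𝓘(ℝ, Fib k) ∞
      (fun z => (e ⟨z, T.fib z (e.symm z y)⟩).2) x := by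
    intro y
    have h1 : ContMDiffAt (𝓡 n) ((𝓡 n).prod 𝓘(ℝ, Fib k)) ∞
        (fun z => (⟨z, e.symm z y⟩ : TotalSpace (Fib k) V)) x := by
      refine contMDiffAt_of_triv he hs contMDiffAt_id ?_
      have h : ContMDiffAt (𝓡 n) 𝓘(ℝ, Fib k) ∞ (fun _ => y) x := contMDiffAt_const
      refine h.congr_of_eventuallyEq ?_
      filter_upwards [hs] with z hz
      rw [e.apply_mk_symm hz]
    exact contMDiffAt_triv_snd he (f := fun z => ⟨z, T.fib z (e.symm z y)⟩) hx
      (T.contMDiff_toFun.contMDiffAt.comp x h1)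
  exact contMDiffAt_pi_space.2 fun i => contMDiffAt_pi_space.2 fun j =>
    contMDiffAt_pi_space.1 (hcol (Pi.single j 1)) i

theorem BundleAut.contMDiffAt_comp_fibMatrix (he : e ∈ σ.trivs) (T : BundleAut n k V) {x : X}
    (hx : x ∈ e.baseSet) {χ : X → ℝ} (hχ : ContMDiff (𝓡 n) 𝓘(ℝ, ℝ) ∞ χ) {F : ℝ × FibMat k → ℝ}
    (hF : ContDiffAt ℝ ω F (χ x ^ 2, T.fibMatrix e x)) :
    ContMDiffAt (𝓡 n) 𝓘(ℝ, ℝ) ∞ (fun z => F (χ z ^ 2, T.fibMatrix e z)) x := by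
  -- The fibre matrix is known to be smooth entrywise, in the product space, while `F` lives on the
  -- normed matrix algebra; this linear identification passes between the two.
  let of : (Fin k ⊕ Fin k → Fin k ⊕ Fin k → ℝ) →L[ℝ] FibMat k :=
    LinearMap.toContinuousLinearMap (Matrix.ofLinearEquiv ℝ).toLinearMap
  have hof : ContDiff ℝ ∞
      (fun p : ℝ × (Fin k ⊕ Fin k → Fin k ⊕ Fin k → ℝ) => ((p.1 ^ 2, of p.2) : ℝ × FibMat k)) :=
    (contDiff_fst.pow 2).prodMk (of.contDiff.comp contDiff_snd)
  have hF' : ContDiffAt ℝ ∞ F (χ x ^ 2, T.fibMatrix e x) := hF.of_le le_top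
  have h : ContDiffAt ℝ ∞
      (fun p : ℝ × (Fin k ⊕ Fin k → Fin k ⊕ Fin k → ℝ) => F (p.1 ^ 2, of p.2))
      (χ x, fun i j => T.fibMatrix e x i j) :=
    ContDiffAt.comp (χ x, fun i j => T.fibMatrix e x i j) hF' hof.contDiffAt
  exact ContMDiffAt.comp (g := fun p : ℝ × (Fin k ⊕ Fin k → Fin k ⊕ Fin k → ℝ) =>
    F (p.1 ^ 2, of p.2)) x h.contMDiffAt
    (hχ.contMDiffAt.prodMk_space (T.contMDiffAt_fibMatrix he hx))

end FibreMatrices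

/-! ### Families near the identity, and the homotopy argument. -/

section Families

variable {n k : ℕ} {X : Type*} [TopologicalSpace X] [ChartedSpace (EuclideanSpace ℝ (Fin n)) X]
  {V : X → Type*} [TopologicalSpace (TotalSpace (Fib k) V)]
  [∀ x, AddCommGroup (V x)] [∀ x, Module ℝ (V x)] [∀ x, TopologicalSpace (V x)]
  [FiberBundle (Fib k) V] {ι : Type*} [TopologicalSpace ι]

/-- A family of automorphisms converges to the identity, locally uniformly, as `t → t₀`. -/
def TendstoId (T : ι → BundleAut n k V) (t₀ : ι) : Prop :=
  ∀ p₀ : TotalSpace (Fib k) V, Tendsto (fun q : ι × TotalSpace (Fib k) V => (T q.1).totalMap q.2)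
    (𝓝 (t₀, p₀)) (𝓝 p₀)

variable {σ : SpStructure n k V} {e : Trivialization (Fib k) (π (Fib k) V)} {t₀ : ι}

theorem TendstoId.comp {S T : ι → BundleAut n k V} (hS : TendstoId S t₀) (hT : TendstoId T t₀) :
    TendstoId (fun t => (S t).comp (T t)) t₀ := by
  intro p₀
  have h : Tendsto (fun q : ι × TotalSpace (Fib k) V => (q.1, (T q.1).totalMap q.2))
      (𝓝 (t₀, p₀)) (𝓝 (t₀, p₀)) := by
    rw [nhds_prod_eq]
    refine tendsto_fst.prodMk ?_
    rw [← nhds_prod_eq]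
    exact hT p₀
  exact (hS p₀).comp h

theorem TendstoId.tendsto_fibMatrix {T : ι → BundleAut n k V} (hT : TendstoId T t₀) {x₀ : X}
    (hx : x₀ ∈ e.baseSet) :
    Tendsto (fun q : ι × X => (T q.1).fibMatrix e q.2) (𝓝 (t₀, x₀)) (𝓝 1) := by
  have hcol : ∀ y : Fib k, Tendsto (fun q : ι × X => (e ((T q.1).totalMap ⟨q.2, e.symm q.2 y⟩)).2)
      (𝓝 (t₀, x₀)) (𝓝 y) := by
    intro y
    have hs : Tendsto (fun x : X => (⟨x, e.symm x y⟩ : TotalSpace (Fib k) V)) (𝓝 x₀)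
        (𝓝 ⟨x₀, e.symm x₀ y⟩) := by
      have h1 : ContinuousAt (fun x : X => e.toOpenPartialHomeomorph.symm (x, y)) x₀ :=
        ContinuousAt.comp (f := fun x : X => (x, y))
          (e.toOpenPartialHomeomorph.symm.continuousAt (e.mem_target.2 hx))
          (continuous_id.prodMk continuous_const).continuousAt
      refine (h1.congr ?_).tendsto
      filter_upwards [e.open_baseSet.mem_nhds hx] with x hx'
      exact (e.mk_symm hx' y).symm
    have h2 : Tendsto (fun q : ι × X => (q.1, (⟨q.2, e.symm q.2 y⟩ : TotalSpace (Fib k) V)))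
        (𝓝 (t₀, x₀)) (𝓝 (t₀, ⟨x₀, e.symm x₀ y⟩)) := by
      rw [nhds_prod_eq, nhds_prod_eq]
      exact tendsto_fst.prodMk (hs.comp tendsto_snd)
    have h3 : ContinuousAt (fun p => (e p).2) (⟨x₀, e.symm x₀ y⟩ : TotalSpace (Fib k) V) :=
      continuousAt_snd.comp (e.continuousAt (e.mem_source.2 hx))
    have h4 := h3.tendsto.comp ((hT _).comp h2)
    rwa [e.apply_mk_symm hx] at h4
  refine tendsto_pi_nhds.2 fun i => tendsto_pi_nhds.2 fun j => ?_
  have := tendsto_pi_nhds.1 (hcol (Pi.single j 1)) i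
  rw [Matrix.one_apply, ← Pi.single_apply]
  exact this

theorem continuous_elemShear (g : Bool × Fin k × Fin k) : Continuous (elemShear g) := by
  obtain ⟨s, a, b⟩ := g
  cases s
  · exact Continuous.matrix_fromBlocks continuous_const continuous_const
      (continuous_id.smul continuous_const) continuous_const
  · exact Continuous.matrix_fromBlocks continuous_const (continuous_id.smul continuous_const).neg
      continuous_const continuous_const

/-- A family of symplectic automorphisms converging to the identity is corrected by a family of
factorable ones to a family that is the identity where a given cutoff function is `1`. -/
theorem exists_local_correction [CompactSpace X] (he : e ∈ σ.trivs) {χ : X → ℝ}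
    (hχs : ContMDiff (𝓡 n) 𝓘(ℝ, ℝ) ∞ χ) (hχ : tsupport χ ⊆ e.baseSet)
    {T : ι → BundleAut n k V} (hT : TendstoId T t₀) (hsymp : ∀ t, (T t).IsSymplectic σ) :
    ∃ T' : ι → BundleAut n k V, (∀ t, (T' t).IsFactorable σ) ∧ TendstoId T' t₀ ∧
      ∀ᶠ t in 𝓝 t₀, ∀ x, (χ x = 1 → (T' t).fib x * (T t).fib x = 1) ∧
        ((T t).fib x = 1 → (T' t).fib x = 1) := by
  obtain ⟨L, hL, hL1, hL2⟩ := exists_elemShear_factorization k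
  have hχ0 : ∀ x ∉ e.baseSet, χ x = 0 := fun x hx =>
    image_eq_zero_of_notMem_tsupport fun h => hx (hχ h)
  -- The two local facts needed at `x`: the coefficients are analytic at the matrix of `T t`, and
  -- the factorisation is valid for it.
  let P : ι → X → Prop := fun t x =>
    (∀ q ∈ L, ContDiffAt ℝ ω q.2 (χ x ^ 2, (T t).fibMatrix e x)) ∧
    ((T t).fibMatrix e x ∈ Matrix.symplecticGroup (Fin k) ℝ →
      (L.map fun q => elemShear q.1 (q.2 (1, (T t).fibMatrix e x))).prod *
        (T t).fibMatrix e x = 1)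
  have hlim : ∀ x₀ ∈ e.baseSet, Tendsto
      (fun z : ι × X => (χ z.2 ^ 2, (T z.1).fibMatrix e z.2)) (𝓝 (t₀, x₀)) (𝓝 (χ x₀ ^ 2, 1)) := by
    intro x₀ hx₀
    rw [nhds_prod_eq (x := χ x₀ ^ 2)]
    refine Tendsto.prodMk ?_ (hT.tendsto_fibMatrix hx₀)
    exact ((hχs.continuous.comp continuous_snd).pow 2).tendsto (t₀, x₀)
  -- Compactness of the support turns joint convergence in `(t, x)` into a statement about all `x`
  -- at once for `t` near `t₀`.
  have hP : ∀ᶠ t in 𝓝 t₀, ∀ x ∈ tsupport χ, P t x := by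
    refine (isClosed_tsupport χ).isCompact.eventually_forall_of_forall_eventually fun x₀ hx₀ => ?_
    have h1 : ∀ᶠ z : ι × X in 𝓝 (t₀, x₀), ∀ q ∈ L,
        ContDiffAt ℝ ω q.2 (χ z.2 ^ 2, (T z.1).fibMatrix e z.2) := by
      -- Analyticity at a point is an open condition, whereas pointwise `ContDiffAt` of order `∞` is
      -- not; this is the use of order `ω`.
      have : ∀ᶠ w in 𝓝 (χ x₀ ^ 2, (1 : FibMat k)), ∀ q ∈ L, ContDiffAt ℝ ω q.2 w := by
        clear hL1 hL2 P
        induction L with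
        | nil => simp
        | cons q L ih =>
          simp only [List.forall_mem_cons] at hL ⊢
          exact ((hL.1 _).eventually (by simp)).and (ih hL.2)
      exact (hlim x₀ (hχ hx₀)).eventually this
    exact h1.and ((hT.tendsto_fibMatrix (hχ hx₀)).eventually hL2)
  have hex : ∀ t, ∃ E : BundleAut n k V, E.IsFactorable σ ∧
      (∀ x, χ x = 0 → E.fib x = 1) ∧
      ((∀ x ∈ tsupport χ, P t x) → ∀ x ∈ e.baseSet, ∀ u : V x, (e ⟨x, E.fib x u⟩).2 =
        ((L.map fun q => elemShear q.1 (χ x ^ 2 * q.2 (χ x ^ 2, (T t).fibMatrix e x))).prod).mulVec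
          (e ⟨x, u⟩).2) := by
    intro t
    by_cases h : ∀ x ∈ tsupport χ, P t x
    · obtain ⟨E, h1, h2, h3⟩ := exists_isFactorable_elemShear he hχs hχ (fun q => q.1)
        (fun q x => q.2 (χ x ^ 2, (T t).fibMatrix e x)) L fun q hq x hx =>
          (T t).contMDiffAt_comp_fibMatrix he (hχ hx) hχs ((h x hx).1 q hq)
      exact ⟨E, h1, h3, fun _ => h2⟩
    -- For the remaining `t` any factorable automorphism would do, since the conclusions concern
    -- only `t` near `t₀`.
    · exact ⟨BundleAut.one, BundleAut.IsFactorable.of_fib_eq_one fun _ => rfl, fun _ _ => rfl,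
        fun h' => absurd h' h⟩
  choose T' hfac hzero hmat using hex
  refine ⟨T', hfac, ?_, ?_⟩
  · intro p₀
    have hproj : Tendsto (fun z : ι × TotalSpace (Fib k) V => (z.1, z.2.proj)) (𝓝 (t₀, p₀))
        (𝓝 (t₀, p₀.proj)) :=
      (continuous_fst.prodMk ((FiberBundle.continuous_proj (Fib k) V).comp
        continuous_snd)).tendsto (t₀, p₀)
    by_cases hp : p₀.proj ∈ tsupport χ
    · have hb := hχ hp
      have hprod : Tendsto (fun z : ι × X => (L.map fun q => elemShear q.1
          (χ z.2 ^ 2 * q.2 (χ z.2 ^ 2, (T z.1).fibMatrix e z.2))).prod)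
          (𝓝 (t₀, p₀.proj)) (𝓝 1) := by
        -- The cutoff takes arbitrary values on its support, so the product must be trivial at the
        -- identity matrix for every value of the parameter `s = χ²`.
        rw [← hL1 (χ p₀.proj ^ 2)]
        refine tendsto_list_prod L fun q hq => ?_
        refine (continuous_elemShear q.1).continuousAt.tendsto.comp (Tendsto.mul ?_ ?_)
        · exact ((hχs.continuous.comp continuous_snd).pow 2).tendsto (t₀, p₀.proj)
        · exact (hL q hq _).continuousAt.tendsto.comp (hlim _ hb)
      have hsnd : Tendsto (fun z : ι × TotalSpace (Fib k) V => (e z.2).2) (𝓝 (t₀, p₀))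
          (𝓝 (e p₀).2) := by
        have h : ContinuousAt (fun p => (e p).2) p₀ :=
          continuousAt_snd.comp (e.continuousAt (e.mem_source.2 hb))
        exact h.tendsto.comp (continuous_snd.tendsto (t₀, p₀))
      have hmul : Tendsto (fun z : ι × TotalSpace (Fib k) V => ((L.map fun q => elemShear q.1
          (χ z.2.proj ^ 2 * q.2 (χ z.2.proj ^ 2, (T z.1).fibMatrix e z.2.proj))).prod).mulVec
          (e z.2).2) (𝓝 (t₀, p₀)) (𝓝 (e p₀).2) := by
        have hc : Continuous fun w : FibMat k × Fib k => w.1.mulVec w.2 :=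
          continuous_fst.matrix_mulVec continuous_snd
        have := (hc.tendsto (1, (e p₀).2)).comp
          ((hprod.comp hproj).prodMk_nhds hsnd)
        rwa [Matrix.one_mulVec] at this
      have hfin := (e.toOpenPartialHomeomorph.symm.continuousAt
        (x := (p₀.proj, (e p₀).2)) (e.mem_target.2 hb)).tendsto.comp
        (((continuous_snd.tendsto (t₀, p₀.proj)).comp hproj).prodMk_nhds hmul)
      rw [e.symm_apply_mk_proj (e.mem_source.2 hb)] at hfin
      refine hfin.congr' ?_
      filter_upwards [hproj.eventually ((continuous_snd.tendsto (t₀, p₀.proj)).eventually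
        (e.open_baseSet.mem_nhds hb)), (continuous_fst.tendsto (t₀, p₀)).eventually hP]
        with z hz hPz
      simp only [Function.comp]
      have h := hmat z.1 hPz z.2.proj hz z.2.2
      have h' := e.symm_apply_mk_proj (x := (T' z.1).totalMap z.2) (e.mem_source.2 hz)
      rw [← h']
      exact congrArg (fun y => e.toOpenPartialHomeomorph.symm (z.2.proj, y)) h.symm
    · have hev : ∀ᶠ z : ι × TotalSpace (Fib k) V in 𝓝 (t₀, p₀), z.2.proj ∉ tsupport χ :=
        ((continuous_snd.tendsto (t₀, p₀.proj)).comp hproj).eventually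
          ((isClosed_tsupport χ).isOpen_compl.mem_nhds hp)
      refine (continuous_snd.tendsto (t₀, p₀)).congr' ?_
      filter_upwards [hev] with z hz
      have h := hzero z.1 z.2.proj (image_eq_zero_of_notMem_tsupport hz)
      change z.2 = ⟨z.2.proj, (T' z.1).fib z.2.proj z.2.2⟩
      rw [h]
      rfl
  · filter_upwards [hP] with t ht x
    refine ⟨fun hx1 => ?_, fun hx1 => ?_⟩
    · have hxs : x ∈ tsupport χ := subset_tsupport χ (by simp [hx1])
      have hxb := hχ hxs
      refine LinearEquiv.ext fun u => triv_snd_injective hxb ?_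
      have hm := (ht x hxs).2 (BundleAut.fibMatrix_mem_symplecticGroup he (hsymp t) hxb)
      have := hmat t ht x hxb ((T t).fib x u)
      rw [← (T t).fibMatrix_mulVec he hxb, Matrix.mulVec_mulVec] at this
      simp only [hx1, one_pow, one_mul] at this
      rw [hm, Matrix.one_mulVec] at this
      exact this
    · by_cases hxb : x ∈ e.baseSet
      · refine LinearEquiv.ext fun u => triv_snd_injective hxb ?_
        have h1 : (T t).fibMatrix e x = 1 := by
          ext i j
          have : (T t).fibMatrix e x i j = (e ⟨x, e.symm x (Pi.single j 1)⟩).2 i := by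
            rw [BundleAut.fibMatrix, hx1]
            rfl
          rw [this, e.apply_mk_symm hxb, Matrix.one_apply]
          exact Pi.single_apply j 1 i
        have := hmat t ht x hxb u
        rw [h1, hL1, Matrix.one_mulVec] at this
        exact this
      · exact hzero t x (hχ0 x hxb)

/-- Induction on the list of cutoffs: each correction makes the family the identity where `χ = 1`
and does not spoil the points where it already was. With no cutoff left the family is the identity,
and undoing the factorable corrections recovers `T`. -/
theorem eventually_isFactorable_of_cover [CompactSpace X] (l : List (X → ℝ))
    (hl : ∀ χ ∈ l, ContMDiff (𝓡 n) 𝓘(ℝ, ℝ) ∞ χ ∧ ∃ e ∈ σ.trivs, tsupport χ ⊆ e.baseSet)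
    {T : ι → BundleAut n k V} (hT : TendstoId T t₀) (hsymp : ∀ t, (T t).IsSymplectic σ)
    (hl1 : ∀ᶠ t in 𝓝 t₀, ∀ x, (∀ χ ∈ l, χ x ≠ 1) → (T t).fib x = 1) :
    ∀ᶠ t in 𝓝 t₀, (T t).IsFactorable σ := by
  induction l generalizing T with
  | nil =>
    filter_upwards [hl1] with t ht
    exact BundleAut.IsFactorable.of_fib_eq_one fun x => ht x (by simp)
  | cons χ l ih =>
    rw [List.forall_mem_cons] at hl
    obtain ⟨⟨hχs, e, he, hχ⟩, hl⟩ := hl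
    obtain ⟨T', hfac, hT', hev⟩ := exists_local_correction he hχs hχ hT hsymp
    have key := ih hl (hT'.comp hT) (fun t => (hfac t).isSymplectic.comp (hsymp t)) (by
      filter_upwards [hev, hl1] with t h1 h2 x hx
      by_cases hx1 : χ x = 1
      · exact (h1 x).1 hx1
      · have h3 := h2 x (List.forall_mem_cons.2 ⟨hx1, hx⟩)
        rw [BundleAut.comp_fib, (h1 x).2 h3, h3, one_mul])
    filter_upwards [key] with t ht
    exact ((hfac t).inv.comp ht).congr fun x => by simp

/-- Symplectic automorphisms close to the identity are factorable. -/
theorem eventually_isFactorable [T2Space X] [CompactSpace X] [IsManifold (𝓡 n) ∞ X]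
    {T : ι → BundleAut n k V} (hT : TendstoId T t₀) (hsymp : ∀ t, (T t).IsSymplectic σ) :
    ∀ᶠ t in 𝓝 t₀, (T t).IsFactorable σ := by
  have hbump : ∀ x : X, ∃ χ : X → ℝ, ContMDiff (𝓡 n) 𝓘(ℝ, ℝ) ∞ χ ∧
      (∃ e ∈ σ.trivs, tsupport χ ⊆ e.baseSet) ∧ χ =ᶠ[𝓝 x] 1 := by
    intro x
    obtain ⟨e, he, hx⟩ := σ.cover x
    obtain ⟨f, -, hf⟩ := (SmoothBumpFunction.nhds_basis_tsupport (I := 𝓡 n) x).mem_iff.1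
      (e.open_baseSet.mem_nhds hx)
    exact ⟨f, f.contMDiff, ⟨e, he, hf⟩, f.eventuallyEq_one⟩
  choose χ hχs hχ hχ1 using hbump
  -- The bump functions equal `1` on whole neighbourhoods, so finitely many of the sets `{χ x = 1}`
  -- already cover the base.
  obtain ⟨s, -, hs⟩ := isCompact_univ.elim_nhds_subcover (fun x : X => {y | χ x y = 1})
    (fun x _ => hχ1 x)
  refine eventually_isFactorable_of_cover (s.toList.map χ) ?_ hT hsymp ?_
  · intro f hf
    obtain ⟨x, -, rfl⟩ := List.mem_map.1 hf
    exact ⟨hχs x, hχ x⟩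
  · refine Eventually.of_forall fun t y hy => ?_
    obtain ⟨x, hx, hxy⟩ := Set.mem_iUnion₂.1 (hs (Set.mem_univ y))
    exact absurd hxy (hy (χ x) (List.mem_map.2 ⟨x, Finset.mem_toList.2 hx, rfl⟩))

theorem BundleAut.IsNullhomotopic.isFactorable [T2Space X] [CompactSpace X]
    [IsManifold (𝓡 n) ∞ X] {S : BundleAut n k V} (h : S.IsNullhomotopic σ) :
    S.IsFactorable σ := by
  obtain ⟨H, hcont, hsymp, h0, rfl⟩ := h
  have hloc : IsLocallyConstant fun t => (H t).IsFactorable σ := by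
    refine (IsLocallyConstant.iff_eventually_eq _).2 fun t₀ => ?_
    have hT : TendstoId (fun t => (H t).comp (H t₀).inv) t₀ := by
      intro p₀
      have h1 : Continuous fun q : unitInterval × TotalSpace (Fib k) V =>
          (q.1, (H t₀).inv.totalMap q.2) :=
        continuous_fst.prodMk ((H t₀).inv.contMDiff_toFun.continuous.comp continuous_snd)
      have h2 := (hcont.comp h1).tendsto (t₀, p₀)
      have h3 : (⟨p₀.1, (H t₀).fib p₀.1 (((H t₀).fib p₀.1)⁻¹ p₀.2)⟩ :
          TotalSpace (Fib k) V) = p₀ := by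
        rw [← LinearEquiv.mul_apply, mul_inv_cancel]
        rfl
      rw [← h3]
      nth_rewrite 1 [h3]
      exact h2
    filter_upwards [eventually_isFactorable hT
      fun t => (hsymp t).comp (hsymp t₀).inv] with t ht
    refine propext ⟨fun hf => (ht.inv.comp hf).congr fun x => by simp,
      fun hf => (ht.comp hf).congr fun x => by simp⟩
  rw [hloc.apply_eq_of_preconnectedSpace 1 0]
  exact BundleAut.IsFactorable.of_fib_eq_one fun x => LinearEquiv.ext fun u => h0 x u

end Families

end RealSymp

theorem theorem4 {n k : ℕ} {X : Type*} [TopologicalSpace X] [T2Space X] [CompactSpace X]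
    [ChartedSpace (EuclideanSpace ℝ (Fin n)) X] [IsManifold (𝓡 n) ∞ X]
    {V : X → Type*} [TopologicalSpace (Bundle.TotalSpace (RealSymp.Fib k) V)]
    [∀ x, AddCommGroup (V x)] [∀ x, Module ℝ (V x)] [∀ x, TopologicalSpace (V x)]
    [FiberBundle (RealSymp.Fib k) V] [VectorBundle ℝ (RealSymp.Fib k) V]
    [ContMDiffVectorBundle ∞ (RealSymp.Fib k) V (𝓡 n)]
    (σ : RealSymp.SpStructure n k V) (S : RealSymp.BundleAut n k V)
    (hS : S.IsSymplectic σ) (hnull : S.IsNullhomotopic σ) :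
    (∃ E : List (RealSymp.BundleAut n k V),
      S.IsComposition E ∧ ∀ T ∈ E, T.IsElementaryFactor σ) ∧
    (σ.IsLagrangian →
      ∃ E : List (RealSymp.BundleAut n k V),
        S.IsComposition E ∧ ∀ T ∈ E, T.IsElementaryFactor σ ∧ T.RespectsSplitting σ) := by
  -- One list serves both claims: `IsTransvection` carries the splitting condition as an implication
  -- from `IsLagrangian`.
  obtain ⟨E, hE, hfac⟩ := hnull.isFactorable
  exact ⟨⟨E, hE, fun T hT => (hfac T hT).isElementaryFactor⟩, fun hσ => ⟨E, hE, fun T hT =>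
    ⟨(hfac T hT).isElementaryFactor, (hfac T hT).respectsSplitting hσ⟩⟩⟩
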